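/- Let $X$ be a real Banach space and let $c(X)$ be the family of nonempty closed convex subsets of $X$; $cb(X)$, $cwk(X)$ and $ck(X)$ are the subfamilies of bounded, weakly compact and compact sets. Write $s(x^*,C)=\sup_{x\in C}\langle x^*,x\rangle\in(-\infty,\infty]$ and $\|C\|_h=\sup_{x\in C}\|x\|$. Consider $[0,1]$ with Lebesgue measure $\lambda$ and the $\sigma$-algebra $\mathcal L$ of Lebesgue measurable sets. Let $\mathcal C$ be one of $cb(X)$, $cwk(X)$, $ck(X)$. For a multifunction $\Gamma:[0,1]\to c(X)$ such that, for each $x^*\in X^*$, $s(x^*,\Gamma(\cdot))$ is finite a.e., we say that $\Gamma$ is * *Pettis integrable in $\mathcal C$* if every $s(x^*,\Gamma)$ is Lebesgue integrable and for each $A\in\mathcal L$ there is $M_\Gamma(A)\in\mathcal C$ with $s(x^*,M_\Gamma(A))=\int_A s(x^*,\Gamma)\,d\lambda$ for all $x^*$; * *Henstock–Kurzweil–Pettis (HKP)*, resp. *Denjoy–Khintchine–Pettis (DKP)*, *integrable in $\mathcal C$* if for each closed interval $I\subset[0,1]$ there is $N_\Gamma(I)\in\mathcal C$ such that for all $x^*$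 the function $s(x^*,\Gamma)$ is Henstock–Kurzweil, resp. Denjoy–Khintchine, integrable on $I$ with integral $s(x^*,N_\Gamma(I))$. Here a function is Henstock–Kurzweil integrable with $0$ substituted at the points (a null set) where it is infinite, and $\varphi$ is Denjoy–Khintchine integrable on $[a,b]$ with integral $F(b)-F(a)$ if $F$ is an ACG function whose approximate derivative is $\varphi$ a.e. on $[a,b]$; * *weakly McShane integrable in $\mathcal C$* if it is HKP integrable in $\mathcal C$ and every $s(x^*,\Gamma)$ is Lebesgue integrable. A function $f:[0,1]\to X$ is integrable in one of these senses if $t\mapsto\{f(t)\}$ is, with all values of the integral being one-point sets. A selection of $\Gamma$ is a function $f$ with $f(t)\in\Gamma(t)$ for every $t\in[0,1]$. Let $D_\Gamma(t)=\operatorname{diam}\Gamma(t)\in[0,\infty]$. $\Gamma$ satisfies the *DL-condition* if $\overline{\int_0^1}D_\Gamma(t)\,dt<\infty$ (upper integral) and the *Db-condition* if $\operatorname{ess\,sup}_t D_\Gamma(t)<\infty$. **Theorem.** Let $\Gamma:[0,1]\to c(X)$ be integrable in $\mathcal C$ in one of the four senses above, and suppose that $\Gamma$ has at least one selection which is integrable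 in the same sense. 1. $\Gamma$ satisfies the DL-condition if and only if $\Gamma=G+f$ (that is, $\Gamma(t)=G(t)+f(t)$ for every $t\in[0,1]$), where $f$ is a selection of $\Gamma$ integrable in the same sense as $\Gamma$, and $G:[0,1]\to c(X)$ is Pettis integrable in $\mathcal C$ with $\overline{\int_0^1}D_G(t)\,dt<\infty$. 2. $\Gamma$ satisfies the Db-condition if and only if such a representation $\Gamma=G+f$ exists in which, in addition, $G$ is essentially bounded, i.e. $\operatorname{ess\,sup}_t\|G(t)\|_h<\infty$. 3. In every representation $\Gamma=G+f$ as in 1, the indefinite Pettis integral $M_G$ of $G$ has finite variation, i.e. $\sup\sum_{A\in\pi}\|M_G(A)\|_h<\infty$, the supremum being taken over all finite partitions $\pi$ of $[0,1]$ into Lebesgue measurable sets. -/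

import Mathlib

open MeasureTheory Set Filter Topology
open scoped ENNReal

noncomputable section

namespace MultiInt

/-! ### Scalar integrals on compact intervals -/

/-- The real function `φ` is Henstock-Kurzweil integrable on `[a, b]` (where `a < b`)
with integral `v`. -/
def HasHKIntegral (φ : ℝ → ℝ) (a b v : ℝ) : Prop :=
  ∃ h : a < b,
    BoxIntegral.HasIntegral (⟨fun _ => a, fun _ => b, fun _ => h⟩ : BoxIntegral.Box (Fin 1))
      BoxIntegral.IntegrationParams.Henstock (fun x => φ (x 0))
      BoxIntegral.BoxAdditiveMap.volume v

/-- `F` is absolutely continuous (AC) on the set `E`: the increments of `F` over finite families of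
non-overlapping intervals with endpoints in `E` are small when the total length is small. -/
def ACOn (F : ℝ → ℝ) (E : Set ℝ) : Prop :=
  ∀ ε : ℝ, 0 < ε → ∃ η : ℝ, 0 < η ∧ ∀ (n : ℕ) (c d : Fin n → ℝ),
    (∀ i, c i ∈ E ∧ d i ∈ E ∧ c i ≤ d i) →
    (∀ i j, i ≠ j → Disjoint (Ioo (c i) (d i)) (Ioo (c j) (d j))) →
    ∑ i, (d i - c i) < η → ∑ i, |F (d i) - F (c i)| < ε

/-- `F` is ACG on `[a, b]`: it is continuous there, and `[a, b]` is a countable union of sets on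
each of which `F` is AC. -/
def ACG (F : ℝ → ℝ) (a b : ℝ) : Prop :=
  ContinuousOn F (Icc a b) ∧
    ∃ E : ℕ → Set ℝ, (⋃ n, E n) = Icc a b ∧ ∀ n, ACOn F (E n)

/-- `c` is a point of (Lebesgue) density of `E`. -/
def IsDensityPoint (E : Set ℝ) (c : ℝ) : Prop :=
  Tendsto (fun r : ℝ => volume (E ∩ Metric.closedBall c r) / volume (Metric.closedBall c r))
    (𝓝[>] 0) (𝓝 1)

/-- `F` has approximate derivative `l` at `c`. -/
def HasApproxDerivAt (F : ℝ → ℝ) (l c : ℝ) : Prop :=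
  ∃ E : Set ℝ, MeasurableSet E ∧ c ∈ E ∧ IsDensityPoint E c ∧ HasDerivWithinAt F l E c

/-- The real function `φ` is Denjoy-Khintchine integrable on `[a, b]` (where `a < b`)
with integral `v`. -/
def HasDKIntegral (φ : ℝ → ℝ) (a b v : ℝ) : Prop :=
  a < b ∧ ∃ F : ℝ → ℝ, ACG F a b ∧
    (∀ᵐ t ∂(volume.restrict (Icc a b)), HasApproxDerivAt F (φ t) t) ∧ v = F b - F a

/-- Upper integral over `[0, 1]` of an arbitrary function with values in `[0, ∞]`. -/
def upperIntegral (φ : ℝ → ℝ≥0∞) : ℝ≥0∞ :=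
  ⨅ (g : ℝ → ℝ≥0∞) (_ : Measurable g) (_ : ∀ t ∈ Icc (0 : ℝ) 1, φ t ≤ g t),
    ∫⁻ t in Icc (0 : ℝ) 1, g t

/-! ### Families of closed convex sets -/

variable {X : Type*} [NormedAddCommGroup X] [NormedSpace ℝ X]

variable (X) in
/-- `c(X)`: the nonempty closed convex subsets of `X`. -/
def closedConvexSets : Set (Set X) := {C | C.Nonempty ∧ IsClosed C ∧ Convex ℝ C}

/-- The three families `cb(X)`, `cwk(X)` and `ck(X)`. -/
inductive Family where
  | cb
  | cwk
  | ck

variable (X) in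
/-- The bounded, weakly compact, resp. compact members of `c(X)`. -/
def Family.sets : Family → Set (Set X)
  | .cb => {C | C ∈ closedConvexSets X ∧ Bornology.IsBounded C}
  | .cwk => {C | C ∈ closedConvexSets X ∧ IsCompact (toWeakSpace ℝ X '' C)}
  | .ck => {C | C ∈ closedConvexSets X ∧ IsCompact C}

/-- Support function `s(x', C) = sup {⟨x', x⟩ : x ∈ C}`, with values in `[-∞, ∞]`. -/
def supp (x' : X →L[ℝ] ℝ) (C : Set X) : EReal := ⨆ x ∈ C, ((x' x : ℝ) : EReal)

/-- `‖C‖_h = sup {‖x‖ : x ∈ C}`, the Hausdorff distance from `C` to `{0}`. -/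
def hNorm (C : Set X) : ℝ≥0∞ := ⨆ x ∈ C, ‖x‖ₑ

/-! ### Integrals of multifunctions on `[0, 1]`

Multifunctions are maps `ℝ → Set X`; only their values on `[0, 1]` are ever used. -/

/-- For each `x'`, the support function `s(x', Γ(·))` is finite almost everywhere on `[0, 1]`. -/
def ScalarlyFinite (Γ : ℝ → Set X) : Prop :=
  ∀ x' : X →L[ℝ] ℝ, ∀ᵐ t ∂(volume.restrict (Icc (0 : ℝ) 1)),
    supp x' (Γ t) ≠ ⊤ ∧ supp x' (Γ t) ≠ ⊥

/-- Scalar (Lebesgue) integrability on `[0, 1]`. -/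
def ScalarlyIntegrable (Γ : ℝ → Set X) : Prop :=
  ScalarlyFinite Γ ∧
    ∀ x' : X →L[ℝ] ℝ, IntegrableOn (fun t => (supp x' (Γ t)).toReal) (Icc (0 : ℝ) 1)

/-- `M` is the indefinite Pettis integral of `Γ`, with values in `𝒞`, on the Lebesgue measurable
subsets of `[0, 1]`. -/
def IsPettisIntegral (𝒞 : Set (Set X)) (Γ : ℝ → Set X) (M : Set ℝ → Set X) : Prop :=
  ScalarlyIntegrable Γ ∧
    ∀ A : Set ℝ, NullMeasurableSet A volume → A ⊆ Icc 0 1 →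
      M A ∈ 𝒞 ∧ ∀ x' : X →L[ℝ] ℝ,
        supp x' (M A) = ((∫ t in A, (supp x' (Γ t)).toReal : ℝ) : EReal)

/-- Pettis integrability in `𝒞`. -/
def PettisIntegrable (𝒞 : Set (Set X)) (Γ : ℝ → Set X) : Prop :=
  ∃ M : Set ℝ → Set X, IsPettisIntegral 𝒞 Γ M

/-- Henstock-Kurzweil-Pettis integrability in `𝒞`. -/
def HKPIntegrable (𝒞 : Set (Set X)) (Γ : ℝ → Set X) : Prop :=
  ScalarlyFinite Γ ∧
    ∀ a b : ℝ, 0 ≤ a → a < b → b ≤ 1 → ∃ N ∈ 𝒞, ∀ x' : X →L[ℝ] ℝ, ∃ v : ℝ,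
      HasHKIntegral (fun t => (supp x' (Γ t)).toReal) a b v ∧ supp x' N = (v : EReal)

/-- Weak McShane integrability in `𝒞`. -/
def WMSIntegrable (𝒞 : Set (Set X)) (Γ : ℝ → Set X) : Prop :=
  HKPIntegrable 𝒞 Γ ∧ ScalarlyIntegrable Γ

/-- Denjoy-Khintchine-Pettis integrability in `𝒞`. -/
def DKPIntegrable (𝒞 : Set (Set X)) (Γ : ℝ → Set X) : Prop :=
  ScalarlyFinite Γ ∧
    ∀ a b : ℝ, 0 ≤ a → a < b → b ≤ 1 → ∃ N ∈ 𝒞, ∀ x' : X →L[ℝ] ℝ, ∃ v : ℝ,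
      HasDKIntegral (fun t => (supp x' (Γ t)).toReal) a b v ∧ supp x' N = (v : EReal)

/-- The scalarly defined integrals. -/
inductive ScalarIntegral where
  | pettis
  | wMS
  | HKP
  | DKP

/-- Integrability in `𝒞` in the sense of one of the scalarly defined integrals. -/
def ScalarIntegral.IntegrableIn :
    ScalarIntegral → (𝒞 : Set (Set X)) → (Γ : ℝ → Set X) → Prop
  | .pettis => PettisIntegrable
  | .wMS => WMSIntegrable
  | .HKP => HKPIntegrable
  | .DKP => DKPIntegrable

/-- Integrability of a vector function: its scalar integrals are represented by points of `X`. -/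
def ScalarIntegral.VectorIntegrable (k : ScalarIntegral) (f : ℝ → X) : Prop :=
  k.IntegrableIn (range fun x : X => ({x} : Set X)) (fun t => {f t})

/-- `f` is a selection of `Γ` on `[0, 1]` which is integrable in the sense of `k`. -/
def IsIntegrableSelection (k : ScalarIntegral) (Γ : ℝ → Set X) (f : ℝ → X) : Prop :=
  k.VectorIntegrable f ∧ ∀ t ∈ Icc (0 : ℝ) 1, f t ∈ Γ t

/-- `D_Γ(t) = diam Γ(t)`, possibly infinite. -/
def diamFn (Γ : ℝ → Set X) (t : ℝ) : ℝ≥0∞ := Metric.ediam (Γ t)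

/-- The `DL`-condition: the upper integral of `D_Γ` is finite. -/
def DLCondition (Γ : ℝ → Set X) : Prop := upperIntegral (diamFn Γ) < ⊤

/-- The `Db`-condition: `D_Γ` is essentially bounded. -/
def DbCondition (Γ : ℝ → Set X) : Prop :=
  essSup (diamFn Γ) (volume.restrict (Icc (0 : ℝ) 1)) < ⊤

/-- `G` is (essentially) bounded on `[0, 1]`. -/
def EssBounded (G : ℝ → Set X) : Prop :=
  essSup (fun t => hNorm (G t)) (volume.restrict (Icc (0 : ℝ) 1)) < ⊤

/-- Variation on `[0, 1]` of a set-valued function of Lebesgue measurable sets: the supremum of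
`∑ ‖M(A)‖_h` over finite partitions of `[0, 1]` into Lebesgue measurable sets. -/
def variation (M : Set ℝ → Set X) : ℝ≥0∞ :=
  ⨆ (P : Finset (Set ℝ)) (_ : ∀ A ∈ P, NullMeasurableSet A volume)
    (_ : (P : Set (Set ℝ)).PairwiseDisjoint id) (_ : (⋃ A ∈ P, A) = Icc (0 : ℝ) 1),
    ∑ A ∈ P, hNorm (M A)

/-- `Γ = G + f` on `[0, 1]`, where `f` is a selection of `Γ` integrable in the sense of `k`, and `G`
is a multifunction with nonempty closed convex values which is Pettis integrable in `𝒞`. -/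
structure IsDecomposition (k : ScalarIntegral) (𝒞 : Set (Set X)) (Γ G : ℝ → Set X)
    (f : ℝ → X) : Prop where
  selection : IsIntegrableSelection k Γ f
  values : ∀ t ∈ Icc (0 : ℝ) 1, G t ∈ closedConvexSets X
  pettis : PettisIntegrable 𝒞 G
  eq_add : ∀ t ∈ Icc (0 : ℝ) 1, Γ t = (fun x => x + f t) '' G t

end MultiInt

end

/-! Everything is done on the translate `G = Γ - f`, where `f` is the given selection. Since `0 ∈ G
t`, the functions `s(y, G)` are nonnegative, and they satisfy `s(y, G t) ≤ ‖y‖ D_Γ(t)` wherever they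
are finite. Three facts then give the Pettis integral of `G`.

Nonnegativity turns a conditional integral into a Lebesgue integral. In the Denjoy-Khintchine case
the primitive is ACG with approximate derivative `≥ 0` a.e.; property (N) makes it monotone
(`ACG.monotoneOn`), and Lebesgue's differentiation theorem applies. In the Henstock-Kurzweil case
the primitive is monotone by additivity, and the Saks-Henstock lemma identifies its derivative
(`ae_eq_deriv_of_gauge`). Hence the integral of `s(y, G)` over an interval is the support function
of `N - z`, with `N` in the family and `z` the integral of `f`.

A measurable majorant `g` of `D_Γ` with finite integral leads from intervals to measurable sets. A
set `A` is approximated by a finite union of grid cells, with error measured by `g dλ`. The error in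
the integral of `s(y, G)` is at most `‖y‖` times this, hence uniform for bounded `y`. A finite union
of cells is represented by a Minkowski sum, and, `X` being complete, such uniform limits of support
functions are support functions (`exists_mem_of_approx_support`).

The set `M(A)` so obtained lies in `M([0, 1])`, because `s(y, G) ≥ 0`; boundedness, weak compactness
or compactness is thus inherited.

The rest follows from translation invariance of the diameter, from `‖C‖_h ≤ diam C ≤ 2 ‖C‖_h` when
`0 ∈ C`, and from `‖M(A)‖_h ≤ ∫_A g`, which is additive in `A`. -/

namespace MultiInt

/-! ### Grids of the real line -/

/-- The `j`-th cell of the grid of mesh `1 / m`. -/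
def cell (m : ℕ) (j : ℤ) : Set ℝ := Ioc ((j : ℝ) / m) ((j + 1 : ℝ) / m)

lemma mem_cell_ceil {m : ℕ} (hm : 0 < m) (x : ℝ) : x ∈ cell m (⌈x * m⌉ - 1) := by
  have hm' : (0 : ℝ) < m := by exact_mod_cast hm
  have h1 := Int.ceil_lt_add_one (x * m)
  have h2 := Int.le_ceil (x * m)
  simp only [cell, mem_Ioc, Int.cast_sub, Int.cast_one, div_lt_iff₀ hm', le_div_iff₀ hm']
  constructor <;> linarith

lemma eq_of_mem_cell {m : ℕ} (hm : 0 < m) {x : ℝ} {i j : ℤ} (hi : x ∈ cell m i)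
    (hj : x ∈ cell m j) : i = j := by
  have hm' : (0 : ℝ) < m := by exact_mod_cast hm
  simp only [cell, mem_Ioc, div_lt_iff₀ hm', le_div_iff₀ hm'] at hi hj
  have h1 : (i : ℝ) < j + 1 := by linarith
  have h2 : (j : ℝ) < i + 1 := by linarith
  have h1' : i < j + 1 := by exact_mod_cast h1
  have h2' : j < i + 1 := by exact_mod_cast h2
  lia

lemma cell_disjoint {m : ℕ} (hm : 0 < m) {i j : ℤ} (h : i ≠ j) :
    Disjoint (cell m i) (cell m j) :=
  Set.disjoint_left.2 fun _ hi hj => h (eq_of_mem_cell hm hi hj)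

lemma cell_length {m : ℕ} (hm : 0 < m) (j : ℤ) :
    (j + 1 : ℝ) / m - (j : ℝ) / m = 1 / m := by
  have hm' : (0 : ℝ) < m := by exact_mod_cast hm
  field_simp
  ring

lemma cell_lt {m : ℕ} (hm : 0 < m) (j : ℤ) : (j : ℝ) / m < (j + 1 : ℝ) / m := by
  have hm' : (0 : ℝ) < m := by exact_mod_cast hm
  have := cell_length hm j
  have : (0 : ℝ) < 1 / m := by positivity
  linarith

lemma abs_sub_lt_of_mem_cell {m : ℕ} (hm : 0 < m) {j : ℤ} {x y : ℝ} (hx : x ∈ cell m j)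
    (hy : y ∈ cell m j) : |x - y| < 1 / m := by
  have := cell_length hm j
  simp only [cell, mem_Ioc] at hx hy
  rw [abs_lt]
  constructor <;> linarith [hx.1, hx.2, hy.1, hy.2]

lemma measurableSet_cell (m : ℕ) (j : ℤ) : MeasurableSet (cell m j) := measurableSet_Ioc

lemma volume_cell {m : ℕ} (hm : 0 < m) (j : ℤ) : volume (cell m j) = ENNReal.ofReal (1 / m) := by
  rw [cell, Real.volume_Ioc, cell_length hm]

/-- A bounded set meets only finitely many cells of a grid. -/
lemma exists_finset_cells {m : ℕ} (hm : 0 < m) {E : Set ℝ} {a b : ℝ} (hE : E ⊆ Icc a b) :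
    ∃ S : Finset ℤ, (∀ j ∈ S, (E ∩ cell m j).Nonempty) ∧ E ⊆ ⋃ j ∈ S, cell m j := by
  classical
  refine ⟨(Finset.Icc (⌈a * m⌉ - 1) (⌈b * m⌉ - 1)).filter fun j => (E ∩ cell m j).Nonempty,
    fun j hj => (Finset.mem_filter.1 hj).2, fun x hx => ?_⟩
  have hx' := hE hx
  refine mem_iUnion₂.2 ⟨⌈x * m⌉ - 1, ?_, mem_cell_ceil hm x⟩
  rw [Finset.mem_filter, Finset.mem_Icc]
  refine ⟨⟨?_, ?_⟩, x, hx, mem_cell_ceil hm x⟩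
  · have : ⌈a * m⌉ ≤ ⌈x * m⌉ := Int.ceil_mono (by gcongr; exact hx'.1)
    lia
  · have : ⌈x * m⌉ ≤ ⌈b * m⌉ := Int.ceil_mono (by gcongr; exact hx'.2)
    lia

/-- A finite union of cells inside a set of finite measure has small total length. -/
lemma card_mul_le_of_cells_subset {m : ℕ} (hm : 0 < m) {S : Finset ℤ} {U : Set ℝ}
    (h : ∀ j ∈ S, cell m j ⊆ U) :
    ∑ _j ∈ S, ENNReal.ofReal (1 / m) ≤ volume U := by
  calc ∑ _j ∈ S, ENNReal.ofReal (1 / m) = ∑ j ∈ S, volume (cell m j) := by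
        simp only [volume_cell hm]
    _ = volume (⋃ j ∈ S, cell m j) :=
        (measure_biUnion_finset (fun i _ j _ hij => cell_disjoint hm hij)
          fun j _ => measurableSet_cell m j).symm
    _ ≤ volume U := measure_mono (iUnion₂_subset h)

/-! ### Absolute continuity on a set -/

lemma ACOn.mono {F : ℝ → ℝ} {E E' : Set ℝ} (h : ACOn F E) (hE : E' ⊆ E) : ACOn F E' := by
  intro ε hε
  obtain ⟨η, hη, H⟩ := h ε hε
  exact ⟨η, hη, fun n c d hcd => H n c d fun i =>
    ⟨hE (hcd i).1, hE (hcd i).2.1, (hcd i).2.2⟩⟩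

/-- Reindexed from `Fin n` to finsets of integers, the index type of grid cells. -/
lemma ACOn.exists_finset {F : ℝ → ℝ} {E : Set ℝ} (h : ACOn F E) {ε : ℝ} (hε : 0 < ε) :
    ∃ η : ℝ, 0 < η ∧ ∀ (S : Finset ℤ) (c d : ℤ → ℝ),
      (∀ i ∈ S, c i ∈ E ∧ d i ∈ E ∧ c i ≤ d i) →
      (∀ i ∈ S, ∀ j ∈ S, i ≠ j → Disjoint (Ioo (c i) (d i)) (Ioo (c j) (d j))) →
      ∑ i ∈ S, (d i - c i) < η → ∑ i ∈ S, |F (d i) - F (c i)| < ε := by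
  obtain ⟨η, hη, H⟩ := h ε hε
  refine ⟨η, hη, fun S c d h1 h2 h3 => ?_⟩
  have key : ∀ g : ℤ → ℝ, ∑ i : Fin S.card, g (S.equivFin.symm i) = ∑ i ∈ S, g i := by
    intro g
    rw [← Finset.sum_coe_sort S, ← Equiv.sum_comp S.equivFin.symm]
  have := H S.card (fun i => c (S.equivFin.symm i)) (fun i => d (S.equivFin.symm i))
    (fun i => h1 _ (S.equivFin.symm i).2)
    (fun i j hij => h2 _ (S.equivFin.symm i).2 _ (S.equivFin.symm j).2
      fun h => hij (S.equivFin.symm.injective (Subtype.ext h)))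
  rw [key fun i => d i - c i, key fun i => |F (d i) - F (c i)|] at this
  exact this h3

lemma ACOn.add {F H : ℝ → ℝ} {E : Set ℝ} (hF : ACOn F E) (hH : ACOn H E) :
    ACOn (fun x => F x + H x) E := by
  intro ε hε
  obtain ⟨η₁, h₁, K₁⟩ := hF (ε / 2) (by positivity)
  obtain ⟨η₂, h₂, K₂⟩ := hH (ε / 2) (by positivity)
  refine ⟨min η₁ η₂, lt_min h₁ h₂, fun n c d hcd hdis hlen => ?_⟩
  have A := K₁ n c d hcd hdis (hlen.trans_le (min_le_left _ _))
  have B := K₂ n c d hcd hdis (hlen.trans_le (min_le_right _ _))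
  calc ∑ i, |F (d i) + H (d i) - (F (c i) + H (c i))|
      ≤ ∑ i, (|F (d i) - F (c i)| + |H (d i) - H (c i)|) := by
        refine Finset.sum_le_sum fun i _ => ?_
        rw [add_sub_add_comm]
        exact abs_add_le _ _
    _ < ε := by rw [Finset.sum_add_distrib]; linarith

lemma ACOn.neg {F : ℝ → ℝ} {E : Set ℝ} (hF : ACOn F E) : ACOn (fun x => -F x) E := by
  intro ε hε
  obtain ⟨η, h, K⟩ := hF ε hε
  refine ⟨η, h, fun n c d hcd hdis hlen => ?_⟩
  have := K n c d hcd hdis hlen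
  simpa only [neg_sub_neg, abs_sub_comm] using this

lemma acOn_mul_id (k : ℝ) (E : Set ℝ) : ACOn (fun x => k * x) E := by
  intro ε hε
  refine ⟨ε / (|k| + 1), by positivity, fun n c d hcd _ hlen => ?_⟩
  calc ∑ i, |k * d i - k * c i| = |k| * ∑ i, (d i - c i) := by
        rw [Finset.mul_sum]
        refine Finset.sum_congr rfl fun i _ => ?_
        rw [← mul_sub, abs_mul, abs_of_nonneg (sub_nonneg.2 (hcd i).2.2)]
    _ ≤ (|k| + 1) * ∑ i, (d i - c i) := by
        have : 0 ≤ ∑ i, (d i - c i) :=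
          Finset.sum_nonneg fun i _ => sub_nonneg.2 (hcd i).2.2
        nlinarith
    _ < ε := by rwa [lt_div_iff₀' (by positivity)] at hlen

lemma ACG.add {F H : ℝ → ℝ} {a b : ℝ} (hF : ACG F a b) (hH : ACG H a b) :
    ACG (fun x => F x + H x) a b := by
  obtain ⟨cF, E, hE, aF⟩ := hF
  obtain ⟨cH, E', hE', aH⟩ := hH
  refine ⟨cF.add cH, fun n => E n.unpair.1 ∩ E' n.unpair.2, ?_, fun n =>
    ((aF _).mono inter_subset_left).add ((aH _).mono inter_subset_right)⟩
  rw [iUnion_unpair fun i j => E i ∩ E' j]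
  simp only [← inter_iUnion, ← iUnion_inter, hE, hE', inter_self]

lemma ACG.neg {F : ℝ → ℝ} {a b : ℝ} (hF : ACG F a b) : ACG (fun x => -F x) a b := by
  obtain ⟨cF, E, hE, aF⟩ := hF
  exact ⟨cF.neg, E, hE, fun n => (aF n).neg⟩

lemma acg_mul_id (k a b : ℝ) : ACG (fun x => k * x) a b :=
  ⟨by fun_prop, fun _ => Icc a b, iUnion_const _, fun _ => acOn_mul_id k _⟩

/-- If all increments were at most half of `|F(S)|`, the diameter of `F '' S`, hence its measure,
would be too. The factor 2 is there because the largest increment need not be attained. -/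
lemma exists_volume_image_le (F : ℝ → ℝ) {S : Set ℝ} (hS : S.Nonempty)
    (hfin : volume (F '' S) ≠ ⊤) :
    ∃ c ∈ S, ∃ d ∈ S, c ≤ d ∧ volume (F '' S) ≤ ENNReal.ofReal (2 * |F d - F c|) := by
  by_contra! H
  set w := (volume (F '' S)).toReal with hw
  have hwv : volume (F '' S) = ENNReal.ofReal w := (ENNReal.ofReal_toReal hfin).symm
  have key : ∀ c ∈ S, ∀ d ∈ S, |F d - F c| ≤ w / 2 := by
    intro c hc d hd
    have aux : ∀ c ∈ S, ∀ d ∈ S, c ≤ d → |F d - F c| ≤ w / 2 := by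
      intro c hc d hd hcd
      have := H c hc d hd hcd
      rw [hwv] at this
      have := (ENNReal.ofReal_lt_ofReal_iff_of_nonneg (by positivity)).1 this
      linarith
    rcases le_total c d with h | h
    · exact aux c hc d hd h
    · rw [abs_sub_comm]; exact aux d hd c hc h
  have hle : volume (F '' S) ≤ ENNReal.ofReal (w / 2) := by
    refine (Real.volume_le_diam _).trans (Metric.ediam_le ?_)
    rintro _ ⟨x, hx, rfl⟩ _ ⟨y, hy, rfl⟩
    rw [edist_dist, Real.dist_eq]
    exact ENNReal.ofReal_le_ofReal (key y hy x hx)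
  have hw0 : 0 ≤ w := ENNReal.toReal_nonneg
  rw [hwv, ENNReal.ofReal_le_ofReal_iff (by linarith)] at hle
  have hw00 : w = 0 := by linarith
  obtain ⟨x, hx⟩ := hS
  have := H x hx x hx le_rfl
  simp [hwv, hw00] at this

/-- Lusin's property `(N)` for functions which are absolutely continuous on a set. -/
theorem ACOn.volume_image_eq_zero {F : ℝ → ℝ} {E : Set ℝ} {a b : ℝ} (hF : ACOn F E)
    (hE : E ⊆ Icc a b) (h0 : volume E = 0) : volume (F '' E) = 0 := by
  by_contra hne
  obtain ⟨ε, hε, hεv⟩ : ∃ ε : ℝ, 0 < ε ∧ ENNReal.ofReal (2 * ε) < volume (F '' E) := by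
    obtain ⟨r, hr0, hr⟩ := ENNReal.lt_iff_exists_nnreal_btwn.1 (pos_iff_ne_zero.2 hne)
    refine ⟨r / 2, by have : 0 < r := by exact_mod_cast hr0
                      positivity, ?_⟩
    rw [mul_div_cancel₀ _ two_ne_zero, ENNReal.ofReal_coe_nnreal]
    exact hr
  obtain ⟨η, hη, H⟩ := hF.exists_finset hε
  obtain ⟨U, hEU, hUo, hU⟩ := E.exists_isOpen_lt_of_lt (ENNReal.ofReal η)
    (by rw [h0]; exact ENNReal.ofReal_pos.2 hη)
  -- At scale `1 / (m + 1)` every cell meeting `Z m` lies in `U`, so these cells have total length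
  -- below `η`. The sets `Z m` increase to `E`.
  let Z : ℕ → Set ℝ := fun m => {x ∈ E | Metric.ball x (1 / (m + 1 : ℕ)) ⊆ U}
  have hZm : Monotone Z := by
    intro m n hmn x hx
    refine ⟨hx.1, (Metric.ball_subset_ball ?_).trans hx.2⟩
    gcongr
  have hZU : ⋃ m, Z m = E := by
    refine Subset.antisymm (iUnion_subset fun m x hx => hx.1) fun x hx => ?_
    obtain ⟨δ, hδ, hb⟩ := Metric.isOpen_iff.1 hUo x (hEU hx)
    obtain ⟨m, hm⟩ := exists_nat_one_div_lt hδ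
    refine mem_iUnion.2 ⟨m, hx, (Metric.ball_subset_ball ?_).trans hb⟩
    push_cast
    exact hm.le
  have hle : ∀ m, volume (F '' Z m) ≤ ENNReal.ofReal (2 * ε) := by
    intro m
    have hm : 0 < m + 1 := m.succ_pos
    obtain ⟨S, hS, hcov⟩ := exists_finset_cells hm ((fun x hx => hE hx.1 : Z m ⊆ Icc a b))
    have hsub : ∀ j ∈ S, cell (m + 1) j ⊆ U := by
      intro j hj y hy
      obtain ⟨x, hx, hxj⟩ := hS j hj
      exact hx.2 (by rw [Metric.mem_ball, Real.dist_eq]; exact abs_sub_lt_of_mem_cell hm hy hxj)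
    have hlen : ∀ T ⊆ S, ∑ _j ∈ T, (1 / (m + 1 : ℕ) : ℝ) < η := by
      intro T hT
      have := (card_mul_le_of_cells_subset hm fun j hj => hsub j (hT hj)).trans_lt hU
      rw [← ENNReal.ofReal_sum_of_nonneg fun _ _ => by positivity] at this
      exact (ENNReal.ofReal_lt_ofReal_iff hη).1 this
    have hinc : ∀ T ⊆ S, ∀ c d : ℤ → ℝ,
        (∀ i ∈ T, c i ∈ Z m ∩ cell (m + 1) i ∧ d i ∈ Z m ∩ cell (m + 1) i ∧ c i ≤ d i) →
        ∑ i ∈ T, |F (d i) - F (c i)| < ε := by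
      intro T hT c d hcd
      refine H T c d (fun i hi => ⟨(hcd i hi).1.1.1, (hcd i hi).2.1.1.1, (hcd i hi).2.2⟩) ?_ ?_
      · intro i hi j hj hij
        refine (cell_disjoint hm hij).mono ?_ ?_
        · exact fun x hx => ⟨(hcd i hi).1.2.1.trans hx.1, hx.2.le.trans (hcd i hi).2.1.2.2⟩
        · exact fun x hx => ⟨(hcd j hj).1.2.1.trans hx.1, hx.2.le.trans (hcd j hj).2.1.2.2⟩
      · refine (Finset.sum_le_sum fun i hi => ?_).trans_lt (hlen T hT)
        exact (le_abs_self _).trans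
          (abs_sub_lt_of_mem_cell hm (hcd i hi).2.1.2 (hcd i hi).1.2).le
    -- A single pair of points in one cell already has increment below `ε`, so each piece has a
    -- bounded image.
    have hfin : ∀ j ∈ S, volume (F '' (Z m ∩ cell (m + 1) j)) ≠ ⊤ := by
      intro j hj
      refine ne_top_of_le_ne_top (ENNReal.ofReal_ne_top (r := ε)) ?_
      refine (Real.volume_le_diam _).trans (Metric.ediam_le ?_)
      have aux : ∀ x ∈ Z m ∩ cell (m + 1) j, ∀ y ∈ Z m ∩ cell (m + 1) j, x ≤ y →
          |F y - F x| ≤ ε := by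
        intro x hx y hy hxy
        have := hinc {j} (by simpa using hj) (fun _ => x) (fun _ => y)
          (by intro i hi; rw [Finset.mem_singleton.1 hi]; exact ⟨hx, hy, hxy⟩)
        simpa using this.le
      rintro _ ⟨x, hx, rfl⟩ _ ⟨y, hy, rfl⟩
      rw [edist_dist, Real.dist_eq]
      refine ENNReal.ofReal_le_ofReal ?_
      rcases le_total x y with h | h
      · rw [abs_sub_comm]; exact aux x hx y hy h
      · exact aux y hy x hx h
    have hpair : ∀ j : ℤ, ∃ c d : ℝ, j ∈ S → (c ∈ Z m ∩ cell (m + 1) j ∧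
        d ∈ Z m ∩ cell (m + 1) j ∧ c ≤ d) ∧
        volume (F '' (Z m ∩ cell (m + 1) j)) ≤ ENNReal.ofReal (2 * |F d - F c|) := by
      intro j
      by_cases hj : j ∈ S
      · obtain ⟨c, hc, d, hd, hcd, h⟩ := exists_volume_image_le F (hS j hj) (hfin j hj)
        exact ⟨c, d, fun _ => ⟨⟨hc, hd, hcd⟩, h⟩⟩
      · exact ⟨0, 0, fun h => absurd h hj⟩
    choose c d hcd using hpair
    have himg : F '' Z m ⊆ ⋃ j ∈ S, F '' (Z m ∩ cell (m + 1) j) := by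
      rintro _ ⟨x, hx, rfl⟩
      obtain ⟨j, hj, hxj⟩ := mem_iUnion₂.1 (hcov hx)
      exact mem_iUnion₂.2 ⟨j, hj, x, ⟨hx, hxj⟩, rfl⟩
    calc volume (F '' Z m) ≤ ∑ j ∈ S, volume (F '' (Z m ∩ cell (m + 1) j)) :=
          (measure_mono himg).trans (measure_biUnion_finset_le S _)
      _ ≤ ∑ j ∈ S, ENNReal.ofReal (2 * |F (d j) - F (c j)|) :=
          Finset.sum_le_sum fun j hj => (hcd j hj).2
      _ = ENNReal.ofReal (2 * ∑ j ∈ S, |F (d j) - F (c j)|) := by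
          rw [← ENNReal.ofReal_sum_of_nonneg fun _ _ => by positivity, Finset.mul_sum]
      _ ≤ ENNReal.ofReal (2 * ε) := by
          have := hinc S subset_rfl c d fun i hi => (hcd i hi).1
          exact ENNReal.ofReal_le_ofReal (by linarith)
  have : volume (F '' E) ≤ ENNReal.ofReal (2 * ε) := by
    rw [← hZU, image_iUnion, Monotone.measure_iUnion fun m n hmn => image_mono (hZm hmn)]
    exact iSup_le hle
  exact absurd this (not_le.2 hεv)

lemma ACG.volume_image_eq_zero {F : ℝ → ℝ} {a b : ℝ} (hF : ACG F a b) {Z : Set ℝ}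
    (hZ : Z ⊆ Icc a b) (h0 : volume Z = 0) : volume (F '' Z) = 0 := by
  obtain ⟨-, E, hE, aF⟩ := hF
  have : F '' Z ⊆ ⋃ n, F '' (Z ∩ E n) := by
    rintro _ ⟨x, hx, rfl⟩
    obtain ⟨n, hn⟩ := mem_iUnion.1 (hE.symm ▸ hZ hx : x ∈ ⋃ n, E n)
    exact mem_iUnion.2 ⟨n, x, ⟨hx, hn⟩, rfl⟩
  refine measure_mono_null this (measure_iUnion_null fun n => ?_)
  exact ((aF n).mono inter_subset_right).volume_image_eq_zero
    (inter_subset_left.trans hZ) (measure_mono_null inter_subset_left h0)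

/-! ### Density points and approximate derivatives -/

lemma isDensityPoint_univ (c : ℝ) : IsDensityPoint univ c := by
  refine tendsto_const_nhds.congr' ?_
  filter_upwards [self_mem_nhdsWithin] with r (hr : 0 < r)
  rw [univ_inter, ENNReal.div_self]
  · rw [Real.volume_closedBall]
    exact (ENNReal.ofReal_pos.2 (by positivity)).ne'
  · rw [Real.volume_closedBall]
    exact ENNReal.ofReal_ne_top

/-- Inclusion-exclusion: in each ball the relative measure of the intersection is at least the sum
of the two relative measures minus 1. -/
lemma IsDensityPoint.inter {E E' : Set ℝ} {c : ℝ} (h : IsDensityPoint E c)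
    (h' : IsDensityPoint E' c) (hE' : MeasurableSet E') : IsDensityPoint (E ∩ E') c := by
  have hlim : Tendsto (fun r : ℝ =>
      volume (E ∩ Metric.closedBall c r) / volume (Metric.closedBall c r) +
      volume (E' ∩ Metric.closedBall c r) / volume (Metric.closedBall c r) - 1)
      (𝓝[>] 0) (𝓝 1) := by
    have := ENNReal.Tendsto.sub (h.add h') (tendsto_const_nhds (x := (1 : ℝ≥0∞)))
      (Or.inr ENNReal.one_ne_top)
    rwa [ENNReal.add_sub_cancel_right ENNReal.one_ne_top] at this
  refine tendsto_of_tendsto_of_tendsto_of_le_of_le' hlim tendsto_const_nhds ?_ ?_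
  · filter_upwards [self_mem_nhdsWithin] with r (hr : 0 < r)
    set B := Metric.closedBall c r with hB
    have hB0 : volume B ≠ 0 := by
      rw [hB, Real.volume_closedBall]
      exact (ENNReal.ofReal_pos.2 (by positivity)).ne'
    have hBt : volume B ≠ ⊤ := by
      rw [hB, Real.volume_closedBall]
      exact ENNReal.ofReal_ne_top
    have hBm : MeasurableSet B := Metric.isClosed_closedBall.measurableSet
    have key : volume (E ∩ B) + volume (E' ∩ B) ≤ volume (E ∩ E' ∩ B) + volume B := by
      rw [← measure_union_add_inter (E ∩ B) (hE'.inter hBm), add_comm, inter_inter_inter_comm,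
        inter_self]
      gcongr
      exact union_subset inter_subset_right inter_subset_right
    rw [tsub_le_iff_right, ← ENNReal.add_div, ← ENNReal.div_self hB0 hBt, ← ENNReal.add_div]
    gcongr
  · refine Eventually.of_forall fun r => ENNReal.div_le_of_le_mul ?_
    rw [one_mul]
    exact measure_mono inter_subset_right

/-- A set missing the right half of small balls has relative measure at most `1 / 2` there. -/
lemma IsDensityPoint.exists_mem_Ioo {E : Set ℝ} {c δ : ℝ} (h : IsDensityPoint E c)
    (hδ : 0 < δ) : ∃ t ∈ E, t ∈ Ioo c (c + δ) := by
  by_contra! H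
  have h1 : ∀ᶠ r in 𝓝[>] (0 : ℝ), (1 / 2 : ℝ≥0∞) <
      volume (E ∩ Metric.closedBall c r) / volume (Metric.closedBall c r) :=
    h.eventually (lt_mem_nhds (by
      rw [one_div]
      exact ENNReal.inv_lt_one.2 ENNReal.one_lt_two))
  have h2 : ∀ᶠ r in 𝓝[>] (0 : ℝ), r ∈ Ioo 0 δ := Ioo_mem_nhdsGT hδ
  obtain ⟨r, hr1, hr0, hrδ⟩ := (h1.and h2).exists
  have hsub : E ∩ Metric.closedBall c r ⊆ Icc (c - r) c := by
    rintro x ⟨hxE, hx⟩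
    rw [Real.closedBall_eq_Icc] at hx
    refine ⟨hx.1, ?_⟩
    by_contra! hcx
    exact H x hxE ⟨hcx, by linarith [hx.2]⟩
  have hle : volume (E ∩ Metric.closedBall c r) ≤ ENNReal.ofReal r := by
    refine (measure_mono hsub).trans ?_
    rw [Real.volume_Icc, sub_sub_cancel]
  have : volume (E ∩ Metric.closedBall c r) / volume (Metric.closedBall c r) ≤ 1 / 2 := by
    rw [Real.volume_closedBall]
    refine ENNReal.div_le_of_le_mul (hle.trans ?_)
    rw [ENNReal.ofReal_mul zero_le_two, ← mul_assoc, ENNReal.ofReal_ofNat, one_div,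
      ENNReal.inv_mul_cancel two_ne_zero ENNReal.ofNat_ne_top, one_mul]
  exact absurd hr1 (not_lt.2 this)

lemma IsDensityPoint.uniqueDiffWithinAt {E : Set ℝ} {c : ℝ} (h : IsDensityPoint E c) :
    UniqueDiffWithinAt ℝ E c := by
  rw [uniqueDiffWithinAt_iff_accPt, accPt_iff_nhds]
  intro U hU
  obtain ⟨δ, hδ, hb⟩ := Metric.mem_nhds_iff.1 hU
  obtain ⟨t, htE, ht⟩ := h.exists_mem_Ioo hδ
  refine ⟨t, ⟨hb ?_, htE⟩, ht.1.ne'⟩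
  rw [Real.ball_eq_Ioo]
  exact ⟨by linarith [ht.1], ht.2⟩

lemma HasApproxDerivAt.add {F H : ℝ → ℝ} {l l' c : ℝ} (hF : HasApproxDerivAt F l c)
    (hH : HasApproxDerivAt H l' c) : HasApproxDerivAt (fun x => F x + H x) (l + l') c := by
  obtain ⟨E, mE, cE, dE, DE⟩ := hF
  obtain ⟨E', mE', cE', dE', DE'⟩ := hH
  exact ⟨E ∩ E', mE.inter mE', ⟨cE, cE'⟩, dE.inter dE' mE',
    (DE.mono inter_subset_left).add (DE'.mono inter_subset_right)⟩

lemma HasApproxDerivAt.neg {F : ℝ → ℝ} {l c : ℝ} (hF : HasApproxDerivAt F l c) :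
    HasApproxDerivAt (fun x => -F x) (-l) c := by
  obtain ⟨E, mE, cE, dE, DE⟩ := hF
  exact ⟨E, mE, cE, dE, DE.neg⟩

lemma _root_.HasDerivAt.hasApproxDerivAt {F : ℝ → ℝ} {l c : ℝ} (h : HasDerivAt F l c) :
    HasApproxDerivAt F l c :=
  ⟨univ, MeasurableSet.univ, mem_univ _, isDensityPoint_univ c, h.hasDerivWithinAt⟩

lemma HasApproxDerivAt.eq_of_hasDerivAt {F : ℝ → ℝ} {l l' c : ℝ} (h : HasApproxDerivAt F l c)
    (h' : HasDerivAt F l' c) : l = l' := by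
  obtain ⟨E, -, -, dE, DE⟩ := h
  exact dE.uniqueDiffWithinAt.eq_deriv E DE h'.hasDerivWithinAt

/-! ### Monotonicity of `ACG` functions -/

lemma HasApproxDerivAt.exists_gt {F : ℝ → ℝ} {l c δ : ℝ} (h : HasApproxDerivAt F l c)
    (hl : 0 < l) (hδ : 0 < δ) : ∃ t ∈ Ioo c (c + δ), F c < F t := by
  obtain ⟨E, -, -, dE, DE⟩ := h
  rw [hasDerivWithinAt_iff_tendsto_slope] at DE
  have h1 : ∀ᶠ t in 𝓝[E \ {c}] c, 0 < slope F c t := DE.eventually (lt_mem_nhds hl)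
  obtain ⟨δ', hδ', hb⟩ := Metric.mem_nhdsWithin_iff.1 h1
  obtain ⟨t, htE, ht⟩ := dE.exists_mem_Ioo (lt_min hδ hδ')
  have htδ : t < c + δ := ht.2.trans_le (by gcongr; exact min_le_left _ _)
  have htδ' : t < c + δ' := ht.2.trans_le (by gcongr; exact min_le_right _ _)
  have := hb ⟨by rw [Real.ball_eq_Ioo]; exact ⟨by linarith [ht.1], htδ'⟩, htE, ht.1.ne'⟩
  refine ⟨t, ⟨ht.1, htδ⟩, ?_⟩
  have hpos : 0 < t - c := sub_pos.2 ht.1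
  rw [mem_ofPred_eq, slope_def_field, lt_div_iff₀ hpos, zero_mul] at this
  linarith

/-- If `F` decreased from `c` to `d`, some intermediate level would avoid the null image of the
exceptional set. At the last point where `F` reaches that level the approximate derivative is
positive, so `F` exceeds the level again further right. -/
lemma ACG.monotoneOn_of_pos {F : ℝ → ℝ} {a b : ℝ} (hF : ACG F a b)
    (hd : ∀ᵐ t ∂(volume.restrict (Icc a b)), ∃ l, 0 < l ∧ HasApproxDerivAt F l t) :
    MonotoneOn F (Icc a b) := by
  rw [ae_restrict_iff' measurableSet_Icc] at hd
  set Z : Set ℝ := {t | ¬(t ∈ Icc a b → ∃ l, 0 < l ∧ HasApproxDerivAt F l t)} with hZ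
  have hZ0 : volume Z = 0 := hd
  have hZs : Z ⊆ Icc a b := fun t ht => (Classical.not_imp.1 ht).1
  have himg := hF.volume_image_eq_zero hZs hZ0
  intro c hc d hd' hcd
  by_contra! hlt
  obtain ⟨y, hy, hyZ⟩ : ∃ y ∈ Ioo (F d) (F c), y ∉ F '' Z := by
    by_contra! H
    have h1 : volume (Ioo (F d) (F c)) = 0 := measure_mono_null H himg
    rw [Real.volume_Ioo, ENNReal.ofReal_eq_zero] at h1
    linarith
  have hsub : Icc c d ⊆ Icc a b := Icc_subset_Icc hc.1 hd'.2
  have hcont : ContinuousOn F (Icc c d) := hF.1.mono hsub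
  set T := Icc c d ∩ F ⁻¹' Ici y with hT
  have hTc : IsCompact T :=
    isCompact_Icc.of_isClosed_subset (hcont.preimage_isClosed_of_isClosed isClosed_Icc isClosed_Ici)
      inter_subset_left
  have hTne : T.Nonempty := ⟨c, ⟨le_rfl, hcd⟩, hy.2.le⟩
  -- The last point of `[c, d]` at which `F ≥ y`; by the intermediate value theorem `F x = y`.
  obtain ⟨x, hx⟩ := hTc.exists_isGreatest hTne
  have hxd : x < d := lt_of_le_of_ne hx.1.1.2 (by
    rintro rfl
    exact absurd hx.1.2 (not_le.2 hy.1))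
  have hxy : F x = y := by
    refine le_antisymm ?_ hx.1.2
    by_contra! hgt
    have hcont' : ContinuousOn F (Icc x d) := hcont.mono (Icc_subset_Icc_left hx.1.1.1)
    obtain ⟨z, hz, hzy⟩ := intermediate_value_Icc' hxd.le hcont' ⟨hy.1.le, hgt.le⟩
    have : z ≤ x := hx.2 ⟨⟨hx.1.1.1.trans hz.1, hz.2⟩, hzy.ge⟩
    have : z = x := le_antisymm this hz.1
    rw [this] at hzy
    exact hgt.ne' hzy
  have hxZ : x ∉ Z := fun h => hyZ ⟨x, h, hxy⟩
  obtain ⟨l, hl, hl'⟩ := (not_not.1 hxZ) (hsub hx.1.1)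
  obtain ⟨t, ht, hFt⟩ := hl'.exists_gt hl (sub_pos.2 hxd)
  rw [add_sub_cancel] at ht
  have : t ≤ x := hx.2 ⟨⟨hx.1.1.1.trans ht.1.le, ht.2.le⟩, (hxy ▸ hFt.le : y ≤ F t)⟩
  exact absurd ht.1 (not_lt.2 this)

/-- Adding `k * x` makes the approximate derivative strictly positive; then `k` tends to `0`. -/
theorem ACG.monotoneOn {F φ : ℝ → ℝ} {a b : ℝ} (hF : ACG F a b)
    (hd : ∀ᵐ t ∂(volume.restrict (Icc a b)), 0 ≤ φ t ∧ HasApproxDerivAt F (φ t) t) :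
    MonotoneOn F (Icc a b) := by
  intro c hc d hd' hcd
  have key : ∀ k : ℝ, 0 < k → F c + k * c ≤ F d + k * d := by
    intro k hk
    refine (hF.add (acg_mul_id k a b)).monotoneOn_of_pos ?_ hc hd' hcd
    filter_upwards [hd] with t ht
    have : HasDerivAt (fun x => k * x) k t := by simpa using (hasDerivAt_id t).const_mul k
    exact ⟨φ t + k, by linarith [ht.1], ht.2.add this.hasApproxDerivAt⟩
  have hlim : ∀ s : ℝ, Tendsto (fun k : ℝ => F s + k * s) (𝓝[>] 0) (𝓝 (F s)) := by
    intro s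
    have : Continuous fun k : ℝ => F s + k * s := by fun_prop
    simpa using (this.tendsto 0).mono_left nhdsWithin_le_nhds
  exact le_of_tendsto_of_tendsto (hlim c) (hlim d)
    (eventually_of_mem self_mem_nhdsWithin fun k hk => key k hk)

/-! ### Nonnegative Denjoy-Khintchine integrable functions -/

lemma acOn_integral {φ : ℝ → ℝ} {a b : ℝ} (hab : a ≤ b) (hφ : IntervalIntegrable φ volume a b) :
    ACOn (fun x => ∫ t in a..x, φ t) (Icc a b) := by
  intro ε hε
  have hφ' : IntegrableOn φ (Ioc a b) := (intervalIntegrable_iff_integrableOn_Ioc_of_le hab).1 hφ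
  obtain ⟨δ, hδ, H⟩ := exists_pos_setLIntegral_lt_of_measure_lt (f := fun t => ‖φ t‖ₑ)
    (μ := volume.restrict (Ioc a b)) hφ'.2.ne (ε := ENNReal.ofReal ε)
    (ENNReal.ofReal_pos.2 hε).ne'
  obtain ⟨η, hη0, hη⟩ := ENNReal.lt_iff_exists_nnreal_btwn.1 hδ
  refine ⟨η, by exact_mod_cast hη0, fun n c d hcd hdis hlen => ?_⟩
  set A : Set ℝ := ⋃ i, Ioc (c i) (d i) with hA
  -- Disjointness passes from open to half-open intervals: a common point of two of the latter has
  -- common points of the open ones just to its left.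
  have hdis' : Pairwise (Function.onFun Disjoint fun i => Ioc (c i) (d i)) := by
    intro i j hij
    have hd := Set.disjoint_left.1 (hdis i j hij)
    refine Set.disjoint_left.2 fun x hx hy => ?_
    obtain ⟨z, hz1, hz2⟩ := exists_between (max_lt hx.1 hy.1)
    rw [max_lt_iff] at hz1
    exact hd ⟨hz1.1, hz2.trans_le hx.2⟩ ⟨hz1.2, hz2.trans_le hy.2⟩
  have hAab : A ⊆ Ioc a b := iUnion_subset fun i =>
    Ioc_subset_Ioc (hcd i).1.1 (hcd i).2.1.2
  have hvol : volume.restrict (Ioc a b) A < δ := by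
    refine (Measure.restrict_apply_le _ _).trans_lt (lt_of_le_of_lt ?_ hη)
    calc volume A ≤ ∑ i, volume (Ioc (c i) (d i)) := by
          rw [hA]; exact measure_iUnion_fintype_le _ _
      _ = ENNReal.ofReal (∑ i, (d i - c i)) := by
          rw [ENNReal.ofReal_sum_of_nonneg fun i _ => sub_nonneg.2 (hcd i).2.2]
          simp only [Real.volume_Ioc]
      _ ≤ η := ENNReal.ofReal_le_of_le_toReal hlen.le
  have hlt := H A hvol
  rw [Measure.restrict_restrict_of_subset hAab] at hlt
  have hint : ∀ x ∈ Icc a b, IntervalIntegrable φ volume a x := fun x hx =>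
    hφ.mono_set (by rw [uIcc_of_le hx.1, uIcc_of_le hab]; exact Icc_subset_Icc_right hx.2)
  have hsum : ∑ i, |(∫ t in a..d i, φ t) - ∫ t in a..c i, φ t| ≤ ∫ t in A, |φ t| := by
    rw [hA, integral_iUnion_fintype (fun i => measurableSet_Ioc) hdis'
      fun i => (hφ'.mono_set ((subset_iUnion (fun i => Ioc (c i) (d i)) i).trans hAab)).abs]
    refine Finset.sum_le_sum fun i _ => ?_
    rw [intervalIntegral.integral_interval_sub_left (hint _ (hcd i).2.1) (hint _ (hcd i).1),
      intervalIntegral.integral_of_le (hcd i).2.2]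
    exact abs_integral_le_integral_abs
  refine hsum.trans_lt ?_
  have := ofReal_integral_norm_eq_lintegral_enorm (hφ'.mono_set hAab)
  rw [← this] at hlt
  exact (ENNReal.ofReal_lt_ofReal_iff hε).1 hlt

lemma acg_integral {φ : ℝ → ℝ} {a b : ℝ} (hab : a ≤ b) (hφ : IntervalIntegrable φ volume a b) :
    ACG (fun x => ∫ t in a..x, φ t) a b := by
  refine ⟨?_, fun _ => Icc a b, iUnion_const _, fun _ => acOn_integral hab hφ⟩
  have := intervalIntegral.continuousOn_primitive_interval
    ((intervalIntegrable_iff_integrableOn_Icc_of_le hab).1 hφ |>.mono_set (by rw [uIcc_of_le hab]))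
  rwa [uIcc_of_le hab] at this

/-- A monotone function whose derivative is almost everywhere `h`. -/
lemma integrableOn_of_monotoneOn {F h : ℝ → ℝ} {a b : ℝ} (hab : a ≤ b)
    (hF : MonotoneOn F (Icc a b))
    (hd : ∀ᵐ t ∂(volume.restrict (Icc a b)), deriv F t = h t) :
    IntegrableOn h (Icc a b) ∧ ∫ t in Icc a b, h t ≤ F b - F a := by
  have hF' : MonotoneOn F (uIcc a b) := by rwa [uIcc_of_le hab]
  have hi := (intervalIntegrable_iff_integrableOn_Icc_of_le hab).1 hF'.intervalIntegrable_deriv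
  refine ⟨hi.congr hd, ?_⟩
  rw [← integral_congr_ae hd, integral_Icc_eq_integral_Ioc, ← intervalIntegral.integral_of_le hab]
  have hle : 0 ≤ F b - F a :=
    sub_nonneg.2 (hF (left_mem_Icc.2 hab) (right_mem_Icc.2 hab) hab)
  have := hF'.intervalIntegral_deriv_mem_uIcc
  rw [uIcc_of_le hle] at this
  exact this.2

lemma ae_differentiableAt_of_monotoneOn {F : ℝ → ℝ} {a b : ℝ} (hF : MonotoneOn F (Icc a b)) :
    ∀ᵐ t ∂(volume.restrict (Icc a b)), DifferentiableAt ℝ F t := by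
  rw [← restrict_Ioo_eq_restrict_Icc, ae_restrict_iff' measurableSet_Ioo]
  filter_upwards [hF.ae_differentiableWithinAt_of_mem] with t ht hmem
  exact (ht (Ioo_subset_Icc_self hmem)).differentiableAt (Icc_mem_nhds hmem.1 hmem.2)

/-- The primitive is monotone, so it is differentiable a.e. and its derivative agrees with its
approximate derivative `h`. Monotonicity alone gives only `∫ h ≤ v`. -/
theorem HasDKIntegral.integrableOn_of_nonneg {h : ℝ → ℝ} {a b v : ℝ} (H : HasDKIntegral h a b v)
    (hh : ∀ᵐ t ∂(volume.restrict (Icc a b)), 0 ≤ h t) :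
    IntegrableOn h (Icc a b) ∧ ∫ t in Icc a b, h t = v := by
  obtain ⟨hab, F, hF, hd, rfl⟩ := H
  have hmono : MonotoneOn F (Icc a b) := hF.monotoneOn (hh.and hd)
  have hderiv : ∀ᵐ t ∂(volume.restrict (Icc a b)), deriv F t = h t := by
    filter_upwards [hd, ae_differentiableAt_of_monotoneOn hmono] with t h1 h2
    exact (h1.eq_of_hasDerivAt h2.hasDerivAt).symm
  obtain ⟨hint, hle⟩ := integrableOn_of_monotoneOn hab.le hmono hderiv
  refine ⟨hint, le_antisymm hle ?_⟩
  have hii : IntervalIntegrable h volume a b :=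
    (intervalIntegrable_iff_integrableOn_Icc_of_le hab.le).2 hint
  -- The reverse inequality: the Lebesgue primitive minus `F` is ACG with approximate derivative `0`
  -- a.e., hence monotone.
  have hmono' := ((acg_integral hab.le hii).add hF.neg).monotoneOn (φ := fun _ => 0) (by
    have h1 := hii.ae_hasDerivAt_integral
    rw [uIcc_of_le hab.le] at h1
    filter_upwards [hd, ae_restrict_of_ae h1, ae_restrict_mem measurableSet_Icc] with t h2 h3 h4
    refine ⟨le_rfl, ?_⟩
    have := (h3 h4 a (left_mem_Icc.2 hab.le)).hasApproxDerivAt.add h2.neg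
    rwa [add_neg_cancel] at this)
  have := hmono' (left_mem_Icc.2 hab.le) (right_mem_Icc.2 hab.le) hab.le
  simp only [intervalIntegral.integral_same] at this
  rw [integral_Icc_eq_integral_Ioc, ← intervalIntegral.integral_of_le hab.le]
  linarith

lemma HasDKIntegral.sub {φ ψ : ℝ → ℝ} {a b v w : ℝ} (hφ : HasDKIntegral φ a b v)
    (hψ : HasDKIntegral ψ a b w) : HasDKIntegral (fun t => φ t - ψ t) a b (v - w) := by
  obtain ⟨hab, F, hF, hd, rfl⟩ := hφ
  obtain ⟨-, H, hH, hd', rfl⟩ := hψ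
  refine ⟨hab, _, hF.add hH.neg, ?_, by ring⟩
  filter_upwards [hd, hd'] with t h h'
  exact h.add h'.neg

lemma HasDKIntegral.congr_ae {φ ψ : ℝ → ℝ} {a b v : ℝ} (hφ : HasDKIntegral φ a b v)
    (h : ∀ᵐ t ∂(volume.restrict (Icc a b)), φ t = ψ t) : HasDKIntegral ψ a b v := by
  obtain ⟨hab, F, hF, hd, rfl⟩ := hφ
  refine ⟨hab, F, hF, ?_, rfl⟩
  filter_upwards [hd, h] with t h1 h2
  rwa [← h2]

/-! ### Nonnegative Henstock-Kurzweil integrable functions -/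

/-- The interval `(a, b]` as a one-dimensional box. -/
abbrev intervalBox (a b : ℝ) (h : a < b) : BoxIntegral.Box (Fin 1) :=
  ⟨fun _ => a, fun _ => b, fun _ => h⟩

/-- The Henstock-Kurzweil integral over a subinterval. -/
noncomputable abbrev hkIntegral (φ : ℝ → ℝ) (I : BoxIntegral.Box (Fin 1)) : ℝ :=
  BoxIntegral.integral I BoxIntegral.IntegrationParams.Henstock (fun x => φ (x 0))
    BoxIntegral.BoxAdditiveMap.volume

open scoped Classical in
/-- The indefinite Henstock-Kurzweil integral. -/
noncomputable def hkPrimitive (φ : ℝ → ℝ) (a x : ℝ) : ℝ :=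
  if h : a < x then hkIntegral φ (intervalBox a x h) else 0

lemma intervalBox_le {a b c d : ℝ} (hab : a < b) (hcd : c < d) (hac : a ≤ c) (hdb : d ≤ b) :
    intervalBox c d hcd ≤ intervalBox a b hab :=
  BoxIntegral.Box.le_iff_bounds.2 ⟨fun _ => hac, fun _ => hdb⟩

lemma mem_intervalBox {a b : ℝ} (hab : a < b) (x : Fin 1 → ℝ) :
    x ∈ intervalBox a b hab ↔ x 0 ∈ Ioc a b := by
  rw [BoxIntegral.Box.mem_def]
  simp

lemma mem_Icc_intervalBox {a b : ℝ} (hab : a < b) (x : Fin 1 → ℝ) :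
    x ∈ BoxIntegral.Box.Icc (intervalBox a b hab) ↔ x 0 ∈ Icc a b := by
  rw [BoxIntegral.Box.Icc_def]
  simp [Pi.le_def]

lemma hkIntegral_eq_sub {φ : ℝ → ℝ} {a b : ℝ} (hab : a < b)
    (H : BoxIntegral.Integrable (intervalBox a b hab) BoxIntegral.IntegrationParams.Henstock
      (fun x => φ (x 0)) BoxIntegral.BoxAdditiveMap.volume)
    {c d : ℝ} (hcd : c < d) (hac : a ≤ c) (hdb : d ≤ b) :
    hkIntegral φ (intervalBox c d hcd) = hkPrimitive φ a d - hkPrimitive φ a c := by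
  rcases hac.eq_or_lt with rfl | hac'
  · simp [hkPrimitive, hcd]
  · have had : a < d := hac'.trans hcd
    rw [hkPrimitive, hkPrimitive, dif_pos had, dif_pos hac', eq_sub_iff_add_eq, add_comm]
    have hle : (intervalBox a d had : WithTop (BoxIntegral.Box (Fin 1))) ≤
        intervalBox a b hab := WithTop.coe_le_coe.2 (intervalBox_le hab had le_rfl hdb)
    have := H.toBoxAdditive.map_split_add hle 0 c
    have hmem : c ∈ Ioo ((intervalBox a d had).lower 0) ((intervalBox a d had).upper 0) :=
      ⟨hac', hcd⟩
    have hu : ∀ p q : ℝ, Function.update (fun _ : Fin 1 => p) 0 q = fun _ => q := by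
      intro p q
      ext i
      rw [Subsingleton.elim i 0, Function.update_self]
    rw [BoxIntegral.Box.splitLower_def hmem, BoxIntegral.Box.splitUpper_def hmem] at this
    simp only [hu] at this
    exact this

lemma hkIntegral_nonneg {φ : ℝ → ℝ} (hφ : ∀ t, 0 ≤ φ t) (I : BoxIntegral.Box (Fin 1)) :
    0 ≤ hkIntegral φ I := by
  have := BoxIntegral.integral_nonneg (I := I) (l := BoxIntegral.IntegrationParams.Henstock)
    (g := fun x => φ (x 0)) (fun x _ => hφ (x 0)) (volume : Measure (Fin 1 → ℝ))
  exact this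

/-- The Saks-Henstock lemma for families of cells of a grid. -/
lemma exists_gauge_cells {φ : ℝ → ℝ} {a b : ℝ} (hab : a < b)
    (H : BoxIntegral.Integrable (intervalBox a b hab) BoxIntegral.IntegrationParams.Henstock
      (fun x => φ (x 0)) BoxIntegral.BoxAdditiveMap.volume) {ε : ℝ} (hε : 0 < ε) :
    ∃ r : ℝ → ℝ, (∀ x, 0 < r x) ∧ ∀ (m : ℕ) (_ : 0 < m) (S : Finset ℤ) (t : ℤ → ℝ),
      (∀ j ∈ S, t j ∈ cell m j ∧ a ≤ (j : ℝ) / m ∧ (j + 1 : ℝ) / m ≤ b ∧ 1 / m ≤ r (t j)) →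
      |∑ j ∈ S, (φ (t j) * ((j + 1 : ℝ) / m - (j : ℝ) / m) -
        (hkPrimitive φ a ((j + 1 : ℝ) / m) - hkPrimitive φ a ((j : ℝ) / m)))| ≤ ε := by
  classical
  refine ⟨fun x => H.convergenceR ε 0 fun _ => x, fun x => (H.convergenceR ε 0 fun _ => x).2,
    fun m hm S t ht => ?_⟩
  let B : ℤ → BoxIntegral.Box (Fin 1) := fun j => intervalBox _ _ (cell_lt hm j)
  -- Cells are closed on the right, so the right endpoint of a box determines its index.
  let idx : BoxIntegral.Box (Fin 1) → ℤ := fun J => ⌈J.upper 0 * m⌉ - 1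
  have hidx : ∀ j, idx (B j) = j := fun j =>
    eq_of_mem_cell hm (mem_cell_ceil hm _) ⟨cell_lt hm j, le_rfl⟩
  have hBinj : Function.Injective B := Function.LeftInverse.injective hidx
  let π : BoxIntegral.TaggedPrepartition (intervalBox a b hab) :=
    { boxes := S.image B
      le_of_mem' := by
        intro J hJ
        obtain ⟨j, hj, rfl⟩ := Finset.mem_image.1 hJ
        exact intervalBox_le _ _ (ht j hj).2.1 (ht j hj).2.2.1
      pairwiseDisjoint := by
        intro J hJ J' hJ' hne
        obtain ⟨j, hj, rfl⟩ := Finset.mem_image.1 (Finset.mem_coe.1 hJ)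
        obtain ⟨i, hi, rfl⟩ := Finset.mem_image.1 (Finset.mem_coe.1 hJ')
        refine Set.disjoint_left.2 fun x hx hx' => hne ?_
        have h1 := (mem_intervalBox (cell_lt hm j) x).1 hx
        have h2 := (mem_intervalBox (cell_lt hm i) x).1 hx'
        rw [eq_of_mem_cell hm (x := x 0) h1 h2]
      -- Tags must lie in the ambient closed box even for boxes outside the prepartition; `a` is the
      -- default.
      tag := fun J => if J ∈ S.image B then fun _ => t (idx J) else fun _ => a
      tag_mem_Icc := by
        intro J
        split_ifs with hJ
        · obtain ⟨j, hj, rfl⟩ := Finset.mem_image.1 hJ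
          rw [mem_Icc_intervalBox, hidx]
          exact ⟨(ht j hj).2.1.trans (ht j hj).1.1.le, (ht j hj).1.2.trans (ht j hj).2.2.1⟩
        · rw [mem_Icc_intervalBox]
          exact left_mem_Icc.2 hab.le }
  have htag : ∀ j ∈ S, π.tag (B j) = fun _ => t j := by
    intro j hj
    have : B j ∈ S.image B := Finset.mem_image_of_mem B hj
    simp only [π, if_pos this, hidx]
  have hmem : BoxIntegral.IntegrationParams.Henstock.MemBaseSet (intervalBox a b hab) 0
      (H.convergenceR ε 0) π := by
    refine ⟨fun J hJ => ?_, fun _ J hJ => ?_, fun h => ?_, fun h => ?_⟩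
    · obtain ⟨j, hj, rfl⟩ := Finset.mem_image.1 (BoxIntegral.TaggedPrepartition.mem_toPrepartition.1 hJ :
        J ∈ S.image B)
      intro x hx
      have hx' := (mem_Icc_intervalBox (cell_lt hm j) x).1 hx
      rw [htag j hj, Metric.mem_closedBall]
      refine ((dist_pi_le_iff (by positivity)).2 fun i => ?_).trans (ht j hj).2.2.2
      rw [Subsingleton.elim i 0, Real.dist_eq, abs_le]
      have h1 := cell_length hm j
      have h2 := (ht j hj).1
      simp only [cell, mem_Ioc] at h2
      constructor <;> linarith [hx'.1, hx'.2, h2.1, h2.2]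
    · obtain ⟨j, hj, rfl⟩ := Finset.mem_image.1 (BoxIntegral.TaggedPrepartition.mem_toPrepartition.1 hJ :
        J ∈ S.image B)
      rw [htag j hj, mem_Icc_intervalBox]
      exact Ioc_subset_Icc_self (ht j hj).1
    -- The last two conditions concern distortion, which `Henstock` does not restrict.
    · exact absurd h (by decide)
    · exact absurd h (by decide)
  have key := H.dist_integralSum_sum_integral_le_of_memBaseSet hε hmem
  have e1 : BoxIntegral.integralSum (fun x => φ (x 0)) BoxIntegral.BoxAdditiveMap.volume π =
      ∑ j ∈ S, φ (t j) * ((j + 1 : ℝ) / m - (j : ℝ) / m) := by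
    rw [BoxIntegral.integralSum]
    change ∑ J ∈ S.image B, _ = _
    rw [Finset.sum_image fun x _ y _ h => hBinj h]
    refine Finset.sum_congr rfl fun j hj => ?_
    rw [htag j hj, BoxIntegral.BoxAdditiveMap.volume_apply, smul_eq_mul, mul_comm]
    simp [B]
  have e2 : ∑ J ∈ π.boxes, hkIntegral φ J =
      ∑ j ∈ S, (hkPrimitive φ a ((j + 1 : ℝ) / m) - hkPrimitive φ a ((j : ℝ) / m)) := by
    change ∑ J ∈ S.image B, _ = _
    rw [Finset.sum_image fun x _ y _ h => hBinj h]
    exact Finset.sum_congr rfl fun j hj =>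
      hkIntegral_eq_sub hab H (cell_lt hm j) (ht j hj).2.1 (ht j hj).2.2.1
  rw [e1, e2, Real.dist_eq, ← Finset.sum_sub_distrib] at key
  exact key

/-- A set at the points of which the increments of `F` fall short of `φ` is a null set if `F` is an
indefinite Henstock-Kurzweil integral of `φ`. -/
lemma volume_eq_zero_of_increment_gap {φ F : ℝ → ℝ} {a b : ℝ}
    (hF : ∀ ε : ℝ, 0 < ε → ∃ r : ℝ → ℝ, (∀ x, 0 < r x) ∧
      ∀ (m : ℕ) (_ : 0 < m) (S : Finset ℤ) (t : ℤ → ℝ),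
      (∀ j ∈ S, t j ∈ cell m j ∧ a ≤ (j : ℝ) / m ∧ (j + 1 : ℝ) / m ≤ b ∧ 1 / m ≤ r (t j)) →
      ∑ j ∈ S, (φ (t j) * ((j + 1 : ℝ) / m - (j : ℝ) / m) -
        (F ((j + 1 : ℝ) / m) - F ((j : ℝ) / m))) ≤ ε)
    {E : Set ℝ} (hE : E ⊆ Ioo a b) {k : ℝ} (hk : 0 < k)
    (hgap : ∀ x ∈ E, ∃ δ > 0, ∀ u w, u ≤ x → x ≤ w → w - u < δ →
      k * (w - u) ≤ φ x * (w - u) - (F w - F u)) : volume E = 0 := by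
  have main : ∀ ε : ℝ, 0 < ε → volume E ≤ ENNReal.ofReal ε := by
    intro ε hε
    obtain ⟨r, hr, H⟩ := hF (k * ε) (by positivity)
    let Z : ℕ → Set ℝ := fun m => {x ∈ E | 1 / (m + 1 : ℕ) ≤ x - a ∧ 1 / (m + 1 : ℕ) ≤ b - x ∧
      1 / (m + 1 : ℕ) ≤ r x ∧ ∀ u w, u ≤ x → x ≤ w → w - u ≤ 1 / (m + 1 : ℕ) →
      k * (w - u) ≤ φ x * (w - u) - (F w - F u)}
    have hZm : Monotone Z := by
      intro m n hmn x hx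
      have : (1 : ℝ) / (n + 1 : ℕ) ≤ 1 / (m + 1 : ℕ) := by gcongr
      exact ⟨hx.1, this.trans hx.2.1, this.trans hx.2.2.1, this.trans hx.2.2.2.1,
        fun u w hu hw huw => hx.2.2.2.2 u w hu hw (huw.trans this)⟩
    have hZU : ⋃ m, Z m = E := by
      refine Subset.antisymm (iUnion_subset fun m x hx => hx.1) fun x hx => ?_
      obtain ⟨δ, hδ, hg⟩ := hgap x hx
      have hpos : 0 < min (min (x - a) (b - x)) (min (r x) δ) :=
        lt_min (lt_min (sub_pos.2 (hE hx).1) (sub_pos.2 (hE hx).2)) (lt_min (hr x) hδ)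
      obtain ⟨m, hm⟩ := exists_nat_one_div_lt hpos
      simp only [lt_min_iff] at hm
      refine mem_iUnion.2 ⟨m, hx, ?_⟩
      push_cast
      exact ⟨hm.1.1.le, hm.1.2.le, hm.2.1.le,
        fun u w hu hw huw => hg u w hu hw (huw.trans_lt hm.2.2)⟩
    rw [← hZU, hZm.measure_iUnion]
    refine iSup_le fun m => ?_
    have hm : 0 < m + 1 := m.succ_pos
    obtain ⟨S, hS, hcov⟩ := exists_finset_cells hm
      (fun x hx => Ioo_subset_Icc_self (hE hx.1) : Z m ⊆ Icc a b)
    have hch : ∀ j : ℤ, ∃ x, j ∈ S → x ∈ Z m ∩ cell (m + 1) j := fun j => by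
      by_cases hj : j ∈ S
      · exact (hS j hj).imp fun x hx _ => hx
      · exact ⟨0, fun h => absurd h hj⟩
    choose t ht using hch
    have hsum := H (m + 1) hm S t fun j hj => by
      have h1 := cell_length hm j
      obtain ⟨⟨-, h3, h4, h5, -⟩, h2⟩ := ht j hj
      have h6 := h2.1
      have h7 := h2.2
      exact ⟨h2, by linarith, by linarith, h5⟩
    -- Each cell contributes a gap of at least `k` times its length, and the gauge bounds the sum by
    -- `k * ε`.
    have hlow : ∑ _j ∈ S, k * (1 / (m + 1 : ℕ) : ℝ) ≤ k * ε := by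
      refine (Finset.sum_le_sum fun j hj => ?_).trans hsum
      obtain ⟨hx, hxj⟩ := ht j hj
      have := hx.2.2.2.2 _ _ hxj.1.le hxj.2 (cell_length hm j).le
      rwa [cell_length hm j] at this ⊢
    rw [← Finset.mul_sum] at hlow
    have hlow' := le_of_mul_le_mul_left hlow hk
    calc volume (Z m) ≤ ∑ j ∈ S, volume (cell (m + 1) j) :=
          (measure_mono hcov).trans (measure_biUnion_finset_le S _)
      _ = ENNReal.ofReal (∑ _j ∈ S, (1 / (m + 1 : ℕ) : ℝ)) := by
          rw [ENNReal.ofReal_sum_of_nonneg fun _ _ => by positivity]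
          simp only [volume_cell hm]
      _ ≤ ENNReal.ofReal ε := ENNReal.ofReal_le_ofReal hlow'
  refine le_antisymm (ENNReal.le_of_forall_pos_le_add fun ε hε _ => ?_) zero_le
  rw [zero_add, ← ENNReal.ofReal_coe_nnreal]
  exact main ε (by exact_mod_cast hε)

/-- The errors on `[u, x]` and `[x, w]` add up because `x` lies between `u` and `w`. -/
lemma _root_.HasDerivAt.exists_straddle {F : ℝ → ℝ} {l x k : ℝ} (h : HasDerivAt F l x)
    (hk : 0 < k) : ∃ δ > 0, ∀ u w, u ≤ x → x ≤ w → w - u < δ →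
      |F w - F u - l * (w - u)| ≤ k * (w - u) := by
  obtain ⟨δ, hδ, hb⟩ := Metric.eventually_nhds_iff.1 ((hasDerivAt_iff_isLittleO.1 h).def hk)
  refine ⟨δ, hδ, fun u w hu hw huw => ?_⟩
  have h1 := @hb u (by rw [Real.dist_eq, abs_lt]; constructor <;> linarith)
  have h2 := @hb w (by rw [Real.dist_eq, abs_lt]; constructor <;> linarith)
  simp only [Real.norm_eq_abs, smul_eq_mul] at h1 h2
  rw [abs_of_nonneg (sub_nonneg.2 hw)] at h2
  rw [abs_of_nonpos (sub_nonpos.2 hu)] at h1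
  rw [abs_le] at h1 h2 ⊢
  constructor <;> linarith [h1.1, h1.2, h2.1, h2.2]

lemma HasHKIntegral.congr_ae {φ ψ : ℝ → ℝ} {a b v : ℝ} (hφ : HasHKIntegral φ a b v)
    (h : ∀ᵐ t ∂(volume.restrict (Icc a b)), φ t = ψ t) : HasHKIntegral ψ a b v := by
  obtain ⟨hab, H⟩ := hφ
  refine ⟨hab, BoxIntegral.HasIntegral.congr_ae H ?_ rfl⟩
  rw [ae_restrict_iff' measurableSet_Icc] at h
  have h' := (volume_preserving_funUnique (Fin 1) ℝ).quasiMeasurePreserving.ae h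
  filter_upwards [ae_restrict_of_ae h', ae_restrict_mem (BoxIntegral.Box.measurableSet_coe _)]
    with x hx hxI
  exact hx (Ioc_subset_Icc_self ((mem_intervalBox hab x).1 hxI))

lemma HasHKIntegral.sub {φ ψ : ℝ → ℝ} {a b v w : ℝ} (hφ : HasHKIntegral φ a b v)
    (hψ : HasHKIntegral ψ a b w) : HasHKIntegral (fun t => φ t - ψ t) a b (v - w) := by
  obtain ⟨hab, H⟩ := hφ
  obtain ⟨hab', H'⟩ := hψ
  exact ⟨hab, H.sub H'⟩

lemma HasHKIntegral.eq_integral {φ : ℝ → ℝ} {a b v : ℝ} (H : HasHKIntegral φ a b v)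
    (hφ : IntegrableOn φ (Icc a b)) : v = ∫ t in Icc a b, φ t := by
  obtain ⟨hab, H⟩ := H
  have hpre : (MeasurableEquiv.funUnique (Fin 1) ℝ) ⁻¹' Ioc a b = (intervalBox a b hab : Set _) := by
    ext x
    exact (mem_intervalBox hab x).symm
  have mp := volume_preserving_funUnique (Fin 1) ℝ
  have me := (MeasurableEquiv.funUnique (Fin 1) ℝ).measurableEmbedding
  have hint : IntegrableOn (fun x : Fin 1 → ℝ => φ (x 0)) (intervalBox a b hab) := by
    rw [← hpre]
    exact (mp.integrableOn_comp_preimage me).2 (hφ.mono_set Ioc_subset_Icc_self)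
  have := H.unique (hint.hasBoxIntegral BoxIntegral.IntegrationParams.Henstock rfl)
  rw [this, ← hpre, integral_Icc_eq_integral_Ioc]
  exact mp.setIntegral_preimage_emb me φ _

/-- Where `deriv F` and `φ` differ by more than `1 / (n + 1)`, the straddle estimate makes the
increments of `F` miss `φ` systematically, which the gauge condition allows only on a null set. -/
lemma ae_eq_deriv_of_gauge {φ F : ℝ → ℝ} {a b : ℝ} (hmono : MonotoneOn F (Icc a b))
    (hF : ∀ ε : ℝ, 0 < ε → ∃ r : ℝ → ℝ, (∀ x, 0 < r x) ∧
      ∀ (m : ℕ) (_ : 0 < m) (S : Finset ℤ) (t : ℤ → ℝ),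
      (∀ j ∈ S, t j ∈ cell m j ∧ a ≤ (j : ℝ) / m ∧ (j + 1 : ℝ) / m ≤ b ∧ 1 / m ≤ r (t j)) →
      |∑ j ∈ S, (φ (t j) * ((j + 1 : ℝ) / m - (j : ℝ) / m) -
        (F ((j + 1 : ℝ) / m) - F ((j : ℝ) / m)))| ≤ ε) :
    ∀ᵐ t ∂(volume.restrict (Icc a b)), deriv F t = φ t := by
  let E₁ : ℕ → Set ℝ := fun n => {x | x ∈ Ioo a b ∧ DifferentiableAt ℝ F x ∧
    1 / (n + 1 : ℝ) < φ x - deriv F x}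
  let E₂ : ℕ → Set ℝ := fun n => {x | x ∈ Ioo a b ∧ DifferentiableAt ℝ F x ∧
    1 / (n + 1 : ℝ) < deriv F x - φ x}
  have h₁ : ∀ n, volume (E₁ n) = 0 := by
    intro n
    -- Half of the discrepancy absorbs the differentiation error; the other half is the gap.
    have hk : (0 : ℝ) < 1 / (n + 1) / 2 := by positivity
    refine volume_eq_zero_of_increment_gap (φ := φ) (F := F) (a := a) (b := b) ?_
      (fun x hx => hx.1) hk ?_
    · intro ε hε
      obtain ⟨r, hr, H⟩ := hF ε hε
      exact ⟨r, hr, fun m hm S t ht => (abs_le.1 (H m hm S t ht)).2⟩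
    · intro x hx
      obtain ⟨δ, hδ, hs⟩ := hx.2.1.hasDerivAt.exists_straddle hk
      refine ⟨δ, hδ, fun u w hu hw huw => ?_⟩
      have := (abs_le.1 (hs u w hu hw huw)).2
      have h0 : 0 ≤ w - u := by linarith
      nlinarith [hx.2.2]
  have h₂ : ∀ n, volume (E₂ n) = 0 := by
    intro n
    have hk : (0 : ℝ) < 1 / (n + 1) / 2 := by positivity
    refine volume_eq_zero_of_increment_gap (φ := fun x => -φ x) (F := fun x => -F x)
      (a := a) (b := b) ?_ (fun x hx => hx.1) hk ?_
    · intro ε hε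
      obtain ⟨r, hr, H⟩ := hF ε hε
      refine ⟨r, hr, fun m hm S t ht => ?_⟩
      have := (abs_le.1 (H m hm S t ht)).1
      rw [neg_le, ← Finset.sum_neg_distrib] at this
      refine le_of_eq_of_le (Finset.sum_congr rfl fun j _ => ?_) this
      ring
    · intro x hx
      obtain ⟨δ, hδ, hs⟩ := hx.2.1.hasDerivAt.exists_straddle hk
      refine ⟨δ, hδ, fun u w hu hw huw => ?_⟩
      have := (abs_le.1 (hs u w hu hw huw)).1
      have h0 : 0 ≤ w - u := by linarith
      nlinarith [hx.2.2]
  have hnull : ∀ᵐ x ∂(volume : Measure ℝ), ∀ n, x ∉ E₁ n ∧ x ∉ E₂ n := by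
    rw [ae_all_iff]
    exact fun n => (measure_eq_zero_iff_ae_notMem.1 (h₁ n)).and
      (measure_eq_zero_iff_ae_notMem.1 (h₂ n))
  have hdiff := ae_differentiableAt_of_monotoneOn hmono
  rw [← restrict_Ioo_eq_restrict_Icc] at hdiff ⊢
  filter_upwards [hdiff, ae_restrict_of_ae hnull, ae_restrict_mem measurableSet_Ioo] with x hd hx hI
  by_contra hne
  rcases lt_or_gt_of_ne hne with h | h
  · obtain ⟨n, hn⟩ := exists_nat_one_div_lt (sub_pos.2 h)
    exact (hx n).1 ⟨hI, hd, hn⟩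
  · obtain ⟨n, hn⟩ := exists_nat_one_div_lt (sub_pos.2 h)
    exact (hx n).2 ⟨hI, hd, hn⟩

theorem HasHKIntegral.integrableOn_of_nonneg {h : ℝ → ℝ} {a b v : ℝ} (H : HasHKIntegral h a b v)
    (hh : ∀ᵐ t ∂(volume.restrict (Icc a b)), 0 ≤ h t) :
    IntegrableOn h (Icc a b) ∧ ∫ t in Icc a b, h t = v := by
  -- `hkIntegral_nonneg` needs nonnegativity everywhere, so `h` is replaced by its positive part.
  obtain ⟨φ, hφ0, hae⟩ : ∃ φ : ℝ → ℝ, (∀ t, 0 ≤ φ t) ∧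
      ∀ᵐ t ∂(volume.restrict (Icc a b)), h t = φ t :=
    ⟨fun t => max (h t) 0, fun t => le_max_right _ _, hh.mono fun t ht => (max_eq_left ht).symm⟩
  have Hφ := H.congr_ae hae
  obtain ⟨hab, Hb⟩ := id Hφ
  have hI : BoxIntegral.Integrable (intervalBox a b hab) BoxIntegral.IntegrationParams.Henstock
      (fun x => φ (x 0)) BoxIntegral.BoxAdditiveMap.volume := Hb.integrable
  have hmono : MonotoneOn (hkPrimitive φ a) (Icc a b) := by
    intro c hc d hd hcd
    rcases hcd.eq_or_lt with rfl | hlt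
    · exact le_rfl
    · have h1 := hkIntegral_eq_sub hab hI hlt hc.1 hd.2
      have h2 := hkIntegral_nonneg hφ0 (intervalBox c d hlt)
      linarith
  have hderiv := ae_eq_deriv_of_gauge hmono fun ε hε => exists_gauge_cells hab hI hε
  have hint : IntegrableOn h (Icc a b) :=
    (integrableOn_of_monotoneOn hab.le hmono hderiv).1.congr
      (hae.mono fun t ht => ht.symm)
  exact ⟨hint, (H.eq_integral hint).symm⟩

section SupportFunctions

variable {X : Type*} [NormedAddCommGroup X] [NormedSpace ℝ X]

/-! ### Support functions -/

lemma supp_eq_coe_iff {y : X →L[ℝ] ℝ} {C : Set X} (hC : C.Nonempty) {v : ℝ} :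
    supp y C = (v : EReal) ↔ IsLUB (y '' C) v := by
  constructor
  · intro h
    constructor
    · rintro _ ⟨x, hx, rfl⟩
      have : ((y x : ℝ) : EReal) ≤ supp y C := le_iSup₂ (f := fun x _ => ((y x : ℝ) : EReal)) x hx
      rw [h] at this
      exact_mod_cast this
    · intro u hu
      have : supp y C ≤ (u : EReal) := iSup₂_le fun x hx => by
        exact_mod_cast hu (mem_image_of_mem y hx)
      rw [h] at this
      exact_mod_cast this
  · intro h
    have hle : supp y C ≤ (v : EReal) := iSup₂_le fun x hx => by
      exact_mod_cast h.1 (mem_image_of_mem y hx)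
    obtain ⟨x₀, hx₀⟩ := hC
    have hge : ∀ x ∈ C, ((y x : ℝ) : EReal) ≤ supp y C := fun x hx =>
      le_iSup₂ (f := fun x _ => ((y x : ℝ) : EReal)) x hx
    have hbot : supp y C ≠ ⊥ := ne_bot_of_le_ne_bot (EReal.coe_ne_bot _) (hge x₀ hx₀)
    have htop : supp y C ≠ ⊤ := ne_top_of_le_ne_top (EReal.coe_ne_top _) hle
    obtain ⟨r, hr⟩ : ∃ r : ℝ, supp y C = r := ⟨_, (EReal.coe_toReal htop hbot).symm⟩
    rw [hr] at hge hle ⊢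
    refine le_antisymm hle ?_
    have : v ≤ r := h.2 (by
      rintro _ ⟨x, hx, rfl⟩
      exact_mod_cast hge x hx)
    exact_mod_cast this

lemma supp_singleton (y : X →L[ℝ] ℝ) (x : X) : supp y {x} = ((y x : ℝ) : EReal) := by
  rw [supp_eq_coe_iff (singleton_nonempty x), image_singleton]
  exact isLUB_singleton

lemma supp_image_sub {y : X →L[ℝ] ℝ} {C : Set X} (hC : C.Nonempty) {v : ℝ}
    (h : supp y C = (v : EReal)) (a : X) :
    supp y ((fun x => x - a) '' C) = ((v - y a : ℝ) : EReal) := by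
  rw [supp_eq_coe_iff hC] at h
  rw [supp_eq_coe_iff (hC.image _)]
  constructor
  · rintro _ ⟨_, ⟨x, hx, rfl⟩, rfl⟩
    rw [map_sub]
    exact sub_le_sub_right (h.1 (mem_image_of_mem y hx)) _
  · intro u hu
    rw [sub_le_iff_le_add]
    refine h.2 ?_
    rintro _ ⟨x, hx, rfl⟩
    have := hu ⟨_, ⟨x, hx, rfl⟩, rfl⟩
    rw [map_sub] at this
    linarith

lemma toReal_supp_nonneg {C : Set X} (h0 : (0 : X) ∈ C) (y : X →L[ℝ] ℝ) :
    0 ≤ (supp y C).toReal := by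
  refine EReal.toReal_nonneg ?_
  have := le_iSup₂ (f := fun x (_ : x ∈ C) => ((y x : ℝ) : EReal)) 0 h0
  rw [map_zero] at this
  exact_mod_cast this

lemma enorm_toReal_supp_le {C : Set X} (h0 : (0 : X) ∈ C) (y : X →L[ℝ] ℝ) :
    ‖(supp y C).toReal‖ₑ ≤ ‖y‖ₑ * Metric.ediam C := by
  have hnn := toReal_supp_nonneg h0 y
  rw [Real.enorm_eq_ofReal hnn]
  by_cases hD : ‖y‖ₑ * Metric.ediam C = ⊤
  · rw [hD]; exact le_top
  -- An infinite support function has `toReal` equal to `0`, so the bound holds at every point and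
  -- not just almost everywhere.
  by_cases htop : supp y C = ⊤
  · simp [htop]
  have hbot : supp y C ≠ ⊥ := by
    refine ne_bot_of_le_ne_bot (EReal.coe_ne_bot (y 0)) ?_
    exact le_iSup₂ (f := fun x (_ : x ∈ C) => ((y x : ℝ) : EReal)) 0 h0
  have hlub := (supp_eq_coe_iff ⟨0, h0⟩).1 (EReal.coe_toReal htop hbot).symm
  refine ENNReal.ofReal_le_of_le_toReal (hlub.2 ?_)
  rintro _ ⟨x, hx, rfl⟩
  rw [← ENNReal.ofReal_le_iff_le_toReal hD]
  calc ENNReal.ofReal (y x) ≤ ‖y x‖ₑ := by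
        rw [← ofReal_norm]
        exact ENNReal.ofReal_le_ofReal (le_abs_self _)
    _ ≤ ‖y‖ₑ * ‖x‖ₑ := y.le_opENorm x
    _ ≤ ‖y‖ₑ * Metric.ediam C := by
        gcongr
        have := Metric.edist_le_ediam_of_mem hx h0
        rwa [edist_zero_right] at this

/-- The points of a convex set are close to any convex set with nearly the same support function. -/
lemma exists_mem_norm_sub_le {C D : Set X} (hD : D.Nonempty) (hDc : Convex ℝ D)
    {q r : (X →L[ℝ] ℝ) → ℝ} (hq : ∀ y : X →L[ℝ] ℝ, IsLUB (y '' C) (q y))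
    (hr : ∀ y : X →L[ℝ] ℝ, IsLUB (y '' D) (r y)) {δ : ℝ} (hδ : 0 < δ)
    (h : ∀ y, q y ≤ r y + δ * ‖y‖) {x : X} (hx : x ∈ C) :
    ∃ z ∈ D, ‖z - x‖ ≤ 2 * δ := by
  by_contra! H
  have hdis : Disjoint (Metric.ball x (2 * δ)) D := Set.disjoint_left.2 fun z hz hzD => by
    rw [Metric.mem_ball, dist_eq_norm] at hz
    exact absurd (H z hzD) (not_lt.2 hz.le)
  obtain ⟨f, u, hfu, hfD⟩ := geometric_hahn_banach_open (convex_ball x (2 * δ))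
    Metric.isOpen_ball hDc hdis
  have hxu : f x < u := hfu x (Metric.mem_ball_self (by positivity))
  -- Any radius strictly between `δ` and `2 * δ` would do: it must stay inside the open ball yet
  -- beat the bound `u - f x ≤ δ * ‖f‖` given by `h`. The two together force `f = 0`.
  have hf : ‖f‖ * (3 / 2 * δ) ≤ u - f x := by
    rw [← le_div_iff₀ (by positivity)]
    refine f.opNorm_le_bound (div_nonneg (by linarith) (by positivity)) fun z => ?_
    have aux : ∀ z : X, f z ≤ (u - f x) / (3 / 2 * δ) * ‖z‖ := by
      intro z
      rcases eq_or_ne z 0 with rfl | hz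
      · simp
      have hz' : 0 < ‖z‖ := norm_pos_iff.2 hz
      have hmem : x + (3 / 2 * δ / ‖z‖) • z ∈ Metric.ball x (2 * δ) := by
        rw [Metric.mem_ball, dist_eq_norm, add_sub_cancel_left, norm_smul, Real.norm_eq_abs,
          abs_of_pos (by positivity), div_mul_cancel₀ _ hz'.ne']
        linarith
      have := hfu _ hmem
      rw [map_add, map_smul, smul_eq_mul] at this
      rw [div_mul_eq_mul_div, le_div_iff₀ (by positivity)]
      have h2 : 3 / 2 * δ / ‖z‖ * f z < u - f x := by linarith
      rw [div_mul_eq_mul_div, div_lt_iff₀ hz'] at h2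
      linarith
    rw [Real.norm_eq_abs, abs_le]
    have h1 := aux (-z)
    rw [map_neg, norm_neg] at h1
    exact ⟨by linarith, aux z⟩
  have h1 : -f x ≤ q (-f) := (hq (-f)).1 ⟨x, hx, rfl⟩
  have h2 : r (-f) ≤ -u := (hr (-f)).2 (by
    rintro _ ⟨z, hz, rfl⟩
    exact neg_le_neg (hfD z hz))
  have h3 := h (-f)
  rw [norm_neg] at h3
  have h4 : ‖f‖ ≤ 0 := by
    by_contra! hpos
    nlinarith [mul_pos hpos hδ]
  have h5 : f = 0 := norm_le_zero_iff.1 h4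
  obtain ⟨d, hd⟩ := hD
  have := hfD d hd
  rw [h5] at this hxu
  exact absurd hxu (not_lt.2 this)

/-- A uniform limit on bounded sets of support functions is a support function. -/
theorem exists_mem_of_approx_support [CompleteSpace X] {p : (X →L[ℝ] ℝ) → ℝ}
    (h : ∀ ε : ℝ, 0 < ε → ∃ (C : Set X) (q : (X →L[ℝ] ℝ) → ℝ), C.Nonempty ∧ Convex ℝ C ∧
      ∀ y : X →L[ℝ] ℝ, IsLUB (y '' C) (q y) ∧ |q y - p y| ≤ ε * ‖y‖)
    (y₀ : X →L[ℝ] ℝ) {η : ℝ} (hη : 0 < η) :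
    ∃ x : X, (∀ y : X →L[ℝ] ℝ, y x ≤ p y) ∧ p y₀ - η ≤ y₀ x := by
  -- The loss at `y₀` is `κ` for choosing `x₀`, `κ * ‖y₀‖` for replacing `q 0` by `p`, and `8 * κ *
  -- ‖y₀‖` for passing to the limit of the sequence.
  set κ : ℝ := η / (1 + 9 * ‖y₀‖) with hκ
  have hκ0 : 0 < κ := by positivity
  have hκη : κ * (1 + 9 * ‖y₀‖) = η := div_mul_cancel₀ _ (by positivity)
  choose C q hne hconv hCq using fun n : ℕ => h (κ * (1 / 2) ^ n) (by positivity)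
  have hstep : ∀ n, ∀ x : C n, ∃ z : C (n + 1), ‖(z : X) - x‖ ≤ 4 * κ * (1 / 2) ^ n := by
    intro n x
    -- The consecutive errors `κ / 2 ^ n` and `κ / 2 ^ (n + 1)` add up to less than `2 * κ / 2 ^ n`.
    obtain ⟨z, hz, hzx⟩ := exists_mem_norm_sub_le (hne (n + 1)) (hconv (n + 1))
      (fun y => (hCq n y).1) (fun y => (hCq (n + 1) y).1) (δ := 2 * κ * (1 / 2) ^ n)
      (by positivity) (fun y => by
        have h1 := (abs_le.1 (hCq n y).2).2
        have h2 := (abs_le.1 (hCq (n + 1) y).2).1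
        have h3 : 0 ≤ κ * (1 / 2) ^ n * ‖y‖ := by positivity
        rw [pow_succ] at h2
        nlinarith) x.2
    exact ⟨⟨z, hz⟩, hzx.trans_eq (by ring)⟩
  choose next hnext using hstep
  obtain ⟨_, ⟨x₀, hx₀, rfl⟩, hx₀y, -⟩ := (hCq 0 y₀).1.exists_between (sub_lt_self (q 0 y₀) hκ0)
  let seq : ∀ n, C n := fun n => Nat.rec ⟨x₀, hx₀⟩ (fun n x => next n x) n
  let xs : ℕ → X := fun n => (seq n).1
  have hdist : ∀ n, dist (xs n) (xs (n + 1)) ≤ 4 * κ * (1 / 2) ^ n := fun n => by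
    rw [dist_eq_norm, norm_sub_rev]
    exact hnext n (seq n)
  obtain ⟨x, hx⟩ := cauchySeq_tendsto_of_complete
    (cauchySeq_of_le_geometric (1 / 2) (4 * κ) (by norm_num) hdist)
  refine ⟨x, fun y => ?_, ?_⟩
  · have h1 : Tendsto (fun n => y (xs n)) atTop (𝓝 (y x)) := (y.continuous.tendsto x).comp hx
    have h2 : Tendsto (fun n : ℕ => p y + κ * (1 / 2) ^ n * ‖y‖) atTop (𝓝 (p y)) := by
      have := ((tendsto_pow_atTop_nhds_zero_of_lt_one (r := (1 / 2 : ℝ)) (by norm_num)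
        (by norm_num)).const_mul κ).mul_const ‖y‖
      simpa using this.const_add (p y)
    refine le_of_tendsto_of_tendsto' h1 h2 fun n => ?_
    have h3 := (hCq n y).1.1 ⟨xs n, (seq n).2, rfl⟩
    have h4 := (abs_le.1 (hCq n y).2).2
    linarith
  · have h1 := dist_le_of_le_geometric_of_tendsto₀ (1 / 2) (4 * κ) (by norm_num) hdist hx
    have h2 : ‖x₀ - x‖ ≤ 8 * κ := by
      rw [← dist_eq_norm]
      exact h1.trans_eq (by ring)
    have h3 : y₀ x₀ - y₀ x ≤ ‖y₀‖ * (8 * κ) := by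
      rw [← map_sub]
      exact (le_abs_self _).trans ((y₀.le_opNorm _).trans (by gcongr))
    have h4 := (abs_le.1 (hCq 0 y₀).2).1
    rw [pow_zero, mul_one] at h4
    nlinarith

-- Support functions add under Minkowski sums. Closedness is not kept, and the approximation
-- argument does not ask for it.
open scoped Pointwise in
lemma exists_finset_sum_support {ι : Type*} (S : Finset ι) (C : ι → Set X)
    (q : ι → (X →L[ℝ] ℝ) → ℝ)
    (h : ∀ i ∈ S, (C i).Nonempty ∧ Convex ℝ (C i) ∧ ∀ y : X →L[ℝ] ℝ, IsLUB (y '' C i) (q i y)) :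
    ∃ D : Set X, D.Nonempty ∧ Convex ℝ D ∧
      ∀ y : X →L[ℝ] ℝ, IsLUB (y '' D) (∑ i ∈ S, q i y) := by
  classical
  induction S using Finset.induction_on with
  | empty =>
    refine ⟨{0}, singleton_nonempty 0, convex_singleton 0, fun y => ?_⟩
    rw [image_singleton, map_zero, Finset.sum_empty]
    exact isLUB_singleton
  | insert i S hi ih =>
    obtain ⟨D, hD, hDc, hDy⟩ := ih fun j hj => h j (Finset.mem_insert_of_mem hj)
    obtain ⟨hC, hCc, hCy⟩ := h i (Finset.mem_insert_self i S)
    refine ⟨C i + D, hC.add hD, hCc.add hDc, fun y => ?_⟩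
    rw [Set.image_add, Finset.sum_insert hi]
    exact (hCy y).add (hDy y)

/-! ### The families of closed convex sets -/

lemma Family.sets_subset (F : Family) : F.sets X ⊆ closedConvexSets X := by
  cases F <;> exact fun C hC => hC.1

/-- In the weakly compact case this rests on Mazur's theorem: a closed convex set is weakly closed.
-/
lemma Family.mem_of_subset {F : Family} {C N : Set X} (hN : N ∈ F.sets X)
    (hC : C ∈ closedConvexSets X) (h : C ⊆ N) : C ∈ F.sets X := by
  cases F with
  | cb => exact ⟨hC, hN.2.subset h⟩
  | cwk =>
    refine ⟨hC, hN.2.of_isClosed_subset ?_ (image_mono h)⟩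
    have := hC.2.2.toWeakSpace_closure (𝕜 := ℝ)
    rw [hC.2.1.closure_eq] at this
    rw [this]
    exact isClosed_closure
  | ck => exact ⟨hC, hN.2.of_isClosed_subset hC.2.1 h⟩

lemma closedConvexSets.image_sub {C : Set X} (hC : C ∈ closedConvexSets X) (a : X) :
    (fun x => x - a) '' C ∈ closedConvexSets X := by
  refine ⟨hC.1.image _, ?_, ?_⟩
  · exact (Homeomorph.subRight a).isClosedMap _ hC.2.1
  · have := hC.2.2.translate (-a)
    simpa [sub_eq_neg_add] using this

lemma Family.image_sub_mem {F : Family} {C : Set X} (hC : C ∈ F.sets X) (a : X) :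
    (fun x => x - a) '' C ∈ F.sets X := by
  have h1 := closedConvexSets.image_sub (F.sets_subset hC) a
  cases F with
  | cb =>
    refine ⟨h1, ?_⟩
    have : LipschitzWith 1 fun x : X => x - a :=
      LipschitzWith.of_dist_le_mul fun x y => by simp
    exact this.isBounded_image hC.2
  | cwk =>
    refine ⟨h1, ?_⟩
    have h2 : toWeakSpace ℝ X '' ((fun x => x - a) '' C) =
        (fun w => w - toWeakSpace ℝ X a) '' (toWeakSpace ℝ X '' C) := by
      rw [image_image, image_image]
      simp only [map_sub]
    rw [h2]
    exact hC.2.image (by fun_prop)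
  | ck => exact ⟨h1, hC.2.image (by fun_prop)⟩

/-! ### From intervals to measurable sets -/

lemma enorm_setIntegral_le {s : ℝ → ℝ} {g : ℝ → ℝ≥0∞} (hg : Measurable g) {c : ℝ≥0∞}
    (hs : ∀ t ∈ Icc (0 : ℝ) 1, ‖s t‖ₑ ≤ c * g t) {A : Set ℝ} (hA : A ⊆ Icc 0 1) :
    ‖∫ t in A, s t‖ₑ ≤ c * ∫⁻ t in A, g t := by
  rw [← lintegral_const_mul _ hg]
  refine (enorm_integral_le_lintegral_enorm _).trans (lintegral_mono_ae ?_)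
  exact ae_restrict_of_ae_restrict_of_subset hA
    ((ae_restrict_mem measurableSet_Icc).mono hs)

lemma abs_setIntegral_sub_le {s : ℝ → ℝ} (hs : IntegrableOn s (Icc 0 1)) {A B : Set ℝ}
    (hA : MeasurableSet A) (hB : MeasurableSet B) (hA1 : A ⊆ Icc 0 1) (hB1 : B ⊆ Icc 0 1) :
    |(∫ t in A, s t) - ∫ t in B, s t| ≤ |∫ t in A \ B, s t| + |∫ t in B \ A, s t| := by
  rw [← integral_inter_add_sdiff hB (hs.mono_set hA1),
    ← integral_inter_add_sdiff hA (hs.mono_set hB1), inter_comm B A, add_sub_add_left_eq_sub]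
  exact abs_sub _ _

lemma cell_subset_Icc_of_inter_Ioc {m : ℕ} (hm : 0 < m) {j : ℤ}
    (h : (cell m j ∩ Ioc 0 1).Nonempty) : 0 ≤ (j : ℝ) / m ∧ (j + 1 : ℝ) / m ≤ 1 := by
  have hm' : (0 : ℝ) < m := by exact_mod_cast hm
  obtain ⟨x, hx, hx1⟩ := h
  simp only [cell, mem_Ioc, div_lt_iff₀ hm', le_div_iff₀ hm'] at hx
  have h1 : (0 : ℝ) < j + 1 := lt_of_lt_of_le (mul_pos hx1.1 hm') hx.2
  have h2 : (j : ℝ) < m := hx.1.trans_le (by nlinarith [hx1.2])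
  have h1' : (0 : ℤ) < j + 1 := by exact_mod_cast h1
  have h2' : j < m := by exact_mod_cast h2
  have h3 : (0 : ℤ) ≤ j := by lia
  have h4 : j + 1 ≤ m := by lia
  refine ⟨div_nonneg (by exact_mod_cast h3) hm'.le, ?_⟩
  rw [div_le_one hm']
  exact_mod_cast h4

/-- A measurable subset of `(0, 1]` is approximated by finite unions of cells of a grid. -/
lemma exists_cells_approx (μ : Measure ℝ) [IsFiniteMeasure μ] {B : Set ℝ}
    (hB : MeasurableSet B) (hB1 : B ⊆ Ioc 0 1) {ε : ℝ} (hε : 0 < ε) :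
    ∃ (m : ℕ) (_ : 0 < m) (S : Finset ℤ),
      (∀ j ∈ S, 0 ≤ (j : ℝ) / m ∧ (j + 1 : ℝ) / m ≤ 1) ∧
      μ ((⋃ j ∈ S, cell m j) \ B) + μ (B \ ⋃ j ∈ S, cell m j) ≤ ENNReal.ofReal ε := by
  have hε' : ENNReal.ofReal (ε / 2) ≠ 0 := (ENNReal.ofReal_pos.2 (by positivity)).ne'
  -- With `K ⊆ B ⊆ U`, cells finer than the distance from `K` to the complement of `U` that meet `K`
  -- cover `K` and stay in `U`.
  obtain ⟨K, hKB, hK, hμK⟩ := hB.exists_isCompact_sdiff_lt (measure_ne_top μ B) hε'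
  obtain ⟨U, hBU, hU, -, hμU⟩ := hB.exists_isOpen_sdiff_lt (measure_ne_top μ B) hε'
  obtain ⟨δ, hδ, hthick⟩ := hK.exists_thickening_subset_open hU (hKB.trans hBU)
  obtain ⟨n, hn⟩ := exists_nat_one_div_lt hδ
  have hm : 0 < n + 1 := n.succ_pos
  obtain ⟨S, hS, hcov⟩ := exists_finset_cells hm
    ((hKB.trans hB1).trans Ioc_subset_Icc_self)
  refine ⟨n + 1, hm, S, fun j hj => ?_, ?_⟩
  · obtain ⟨x, hxK, hx⟩ := hS j hj
    exact cell_subset_Icc_of_inter_Ioc hm ⟨x, hx, hB1 (hKB hxK)⟩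
  · have hVU : (⋃ j ∈ S, cell (n + 1) j) ⊆ U := by
      refine iUnion₂_subset fun j hj z hz => hthick ?_
      obtain ⟨x, hxK, hx⟩ := hS j hj
      refine Metric.mem_thickening_iff.2 ⟨x, hxK, ?_⟩
      rw [Real.dist_eq]
      refine (abs_sub_lt_of_mem_cell hm hz hx).trans ?_
      push_cast
      exact hn
    calc _ ≤ μ (U \ B) + μ (B \ K) :=
          add_le_add (measure_mono (sdiff_subset_sdiff_left hVU))
            (measure_mono (sdiff_subset_sdiff_right hcov))
      _ ≤ ENNReal.ofReal (ε / 2) + ENNReal.ofReal (ε / 2) := add_le_add hμU.le hμK.le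
      _ = ENNReal.ofReal ε := by
          rw [← ENNReal.ofReal_add (by positivity) (by positivity), add_halves]

/-- The approximating cells are chosen for the finite measure `g dλ`, which does not involve `y`;
this makes the error uniform on bounded sets of functionals. -/
lemma exists_support_approx_of_intervals {s : (X →L[ℝ] ℝ) → ℝ → ℝ} {g : ℝ → ℝ≥0∞}
    (hg : Measurable g) (hgfin : ∫⁻ t in Icc (0 : ℝ) 1, g t < ⊤)
    (hs : ∀ y, IntegrableOn (s y) (Icc 0 1))
    (hsg : ∀ y, ∀ t ∈ Icc (0 : ℝ) 1, ‖s y t‖ₑ ≤ ‖y‖ₑ * g t)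
    (hI : ∀ a b : ℝ, 0 ≤ a → a < b → b ≤ 1 → ∃ N : Set X, N.Nonempty ∧ Convex ℝ N ∧
      ∀ y : X →L[ℝ] ℝ, IsLUB (y '' N) (∫ t in Icc a b, s y t))
    {A : Set ℝ} (hA : NullMeasurableSet A volume) (hA1 : A ⊆ Icc 0 1) {ε : ℝ} (hε : 0 < ε) :
    ∃ (C : Set X) (q : (X →L[ℝ] ℝ) → ℝ), C.Nonempty ∧ Convex ℝ C ∧
      ∀ y : X →L[ℝ] ℝ, IsLUB (y '' C) (q y) ∧ |q y - ∫ t in A, s y t| ≤ ε * ‖y‖ := by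
  obtain ⟨A', hA'A, hA', hAA'⟩ := hA.exists_measurable_subset_ae_eq
  -- The point `0` is dropped because cells are open on the left: a cell ending at `0` would leave
  -- the unit interval.
  set B := A' ∩ Ioc (0 : ℝ) 1 with hBdef
  have hB : MeasurableSet B := hA'.inter measurableSet_Ioc
  have hBA : B =ᵐ[volume] A := by
    have h1 : (Ioc (0 : ℝ) 1 : Set ℝ) =ᵐ[volume] Icc (0 : ℝ) 1 := Ioc_ae_eq_Icc
    have h2 : (A' ∩ Ioc (0 : ℝ) 1 : Set ℝ) =ᵐ[volume] (A ∩ Icc (0 : ℝ) 1 : Set ℝ) := hAA'.inter h1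
    rwa [inter_eq_self_of_subset_left hA1] at h2
  have hB1 : B ⊆ Ioc 0 1 := inter_subset_right
  set μ : Measure ℝ := (volume.restrict (Icc (0 : ℝ) 1)).withDensity g with hμ
  have : IsFiniteMeasure μ := isFiniteMeasure_withDensity hgfin.ne
  have hμD : ∀ D : Set ℝ, MeasurableSet D → D ⊆ Icc 0 1 → ∫⁻ t in D, g t = μ D := by
    intro D hD hD1
    rw [hμ, withDensity_apply _ hD, Measure.restrict_restrict_of_subset hD1]
  obtain ⟨m, hm, S, hS, hVB⟩ := exists_cells_approx μ hB hB1 hε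
  set V := ⋃ j ∈ S, cell m j with hV
  have hVm : MeasurableSet V := S.measurableSet_biUnion fun j _ => measurableSet_cell m j
  have hcell : ∀ j ∈ S, cell m j ⊆ Icc 0 1 := fun j hj x hx =>
    ⟨(hS j hj).1.trans hx.1.le, hx.2.trans (hS j hj).2⟩
  have hV1 : V ⊆ Icc 0 1 := iUnion₂_subset hcell
  have hN : ∀ j : ℤ, ∃ N : Set X, j ∈ S → N.Nonempty ∧ Convex ℝ N ∧
      ∀ y : X →L[ℝ] ℝ, IsLUB (y '' N) (∫ t in cell m j, s y t) := by
    intro j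
    by_cases hj : j ∈ S
    · obtain ⟨N, h1, h2, h3⟩ := hI _ _ (hS j hj).1 (cell_lt hm j) (hS j hj).2
      refine ⟨N, fun _ => ⟨h1, h2, fun y => ?_⟩⟩
      rw [cell, ← integral_Icc_eq_integral_Ioc]
      exact h3 y
    · exact ⟨∅, fun h => absurd h hj⟩
  choose N hN using hN
  obtain ⟨D, hD, hDc, hDy⟩ := exists_finset_sum_support S N
    (fun j y => ∫ t in cell m j, s y t) hN
  refine ⟨D, _, hD, hDc, fun y => ⟨hDy y, ?_⟩⟩
  have hsum : ∑ j ∈ S, ∫ t in cell m j, s y t = ∫ t in V, s y t :=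
    (integral_biUnion_finset S (fun j _ => measurableSet_cell m j)
      (fun i _ j _ hij => cell_disjoint hm hij) fun j hj => (hs y).mono_set (hcell j hj)).symm
  have hBI : B ⊆ Icc 0 1 := hB1.trans Ioc_subset_Icc_self
  have hbound : ∀ D : Set ℝ, MeasurableSet D → D ⊆ Icc 0 1 →
      ENNReal.ofReal |∫ t in D, s y t| ≤ ‖y‖ₑ * μ D := by
    intro D hD hD1
    rw [← hμD D hD hD1, ← Real.norm_eq_abs, ofReal_norm]
    exact enorm_setIntegral_le hg (hsg y) hD1
  rw [hsum, ← setIntegral_congr_set hBA]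
  refine (abs_setIntegral_sub_le (hs y) hVm hB hV1 hBI).trans ?_
  rw [← ENNReal.ofReal_le_ofReal_iff (by positivity),
    ENNReal.ofReal_add (abs_nonneg _) (abs_nonneg _), mul_comm ε,
    ENNReal.ofReal_mul (norm_nonneg y), ofReal_norm]
  calc _ ≤ ‖y‖ₑ * μ (V \ B) + ‖y‖ₑ * μ (B \ V) :=
        add_le_add (hbound _ (hVm.diff hB) (sdiff_subset.trans hV1))
          (hbound _ (hB.diff hVm) (sdiff_subset.trans hBI))
    _ ≤ ‖y‖ₑ * ENNReal.ofReal ε := by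
        rw [← mul_add]
        gcongr

/-- A multifunction containing `0` whose diameter has finite upper integral is Pettis integrable as
soon as its integrals over intervals are represented by members of the family. -/
theorem exists_isPettisIntegral_of_intervals [CompleteSpace X] (F : Family) {G : ℝ → Set X}
    (h0 : ∀ t ∈ Icc (0 : ℝ) 1, (0 : X) ∈ G t) (hG : ScalarlyIntegrable G)
    {g : ℝ → ℝ≥0∞} (hg : Measurable g) (hgfin : ∫⁻ t in Icc (0 : ℝ) 1, g t < ⊤)
    (hGg : ∀ t ∈ Icc (0 : ℝ) 1, diamFn G t ≤ g t)
    (hI : ∀ a b : ℝ, 0 ≤ a → a < b → b ≤ 1 → ∃ N ∈ F.sets X, ∀ y : X →L[ℝ] ℝ,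
      supp y N = ((∫ t in Icc a b, (supp y (G t)).toReal : ℝ) : EReal)) :
    PettisIntegrable (F.sets X) G := by
  set s : (X →L[ℝ] ℝ) → ℝ → ℝ := fun y t => (supp y (G t)).toReal with hs
  have hsg : ∀ y, ∀ t ∈ Icc (0 : ℝ) 1, ‖s y t‖ₑ ≤ ‖y‖ₑ * g t := fun y t ht =>
    (enorm_toReal_supp_le (h0 t ht) y).trans (by gcongr; exact hGg t ht)
  have hI' : ∀ a b : ℝ, 0 ≤ a → a < b → b ≤ 1 → ∃ N : Set X, N.Nonempty ∧ Convex ℝ N ∧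
      ∀ y : X →L[ℝ] ℝ, IsLUB (y '' N) (∫ t in Icc a b, s y t) := by
    intro a b ha hab hb
    obtain ⟨N, hN, hNy⟩ := hI a b ha hab hb
    have hN' := F.sets_subset hN
    exact ⟨N, hN'.1, hN'.2.2, fun y => (supp_eq_coe_iff hN'.1).1 (hNy y)⟩
  obtain ⟨N₁, hN₁, hN₁y⟩ := hI 0 1 le_rfl one_pos le_rfl
  have hN₁' := F.sets_subset hN₁
  -- The largest set whose support function is at most the integral; the task is to show that
  -- equality holds.
  refine ⟨fun A => {x | ∀ y : X →L[ℝ] ℝ, y x ≤ ∫ t in A, s y t}, hG, fun A hA hA1 => ?_⟩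
  set M : Set X := {x | ∀ y : X →L[ℝ] ℝ, y x ≤ ∫ t in A, s y t} with hM
  have happrox : ∀ (y : X →L[ℝ] ℝ) (η : ℝ), 0 < η → ∃ x ∈ M, (∫ t in A, s y t) - η ≤ y x :=
    fun y η hη => exists_mem_of_approx_support (p := fun y => ∫ t in A, s y t)
      (fun ε hε => exists_support_approx_of_intervals hg hgfin hG.2 hsg hI' hA hA1 hε) y hη
  have hMne : M.Nonempty := (happrox 0 1 one_pos).imp fun x hx => hx.1
  have hMcc : M ∈ closedConvexSets X := by
    refine ⟨hMne, ?_, ?_⟩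
    · rw [hM, ofPred_forall]
      exact isClosed_iInter fun y => isClosed_le y.continuous continuous_const
    · rw [hM, ofPred_forall]
      exact convex_iInter fun y => convex_halfSpace_le y.isLinear _
  -- Nonnegativity gives `∫_A s ≤ ∫_[0,1] s`, so no functional separates a point of `M` from `N₁`.
  have hMN : M ⊆ N₁ := by
    intro x hx
    by_contra hxN
    obtain ⟨f, u, hfu, hux⟩ := geometric_hahn_banach_closed_point hN₁'.2.2 hN₁'.2.1 hxN
    have h1 : ∫ t in Icc (0 : ℝ) 1, s f t ≤ u := ((supp_eq_coe_iff hN₁'.1).1 (hN₁y f)).2 (by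
      rintro _ ⟨z, hz, rfl⟩
      exact (hfu z hz).le)
    have h2 : ∫ t in A, s f t ≤ ∫ t in Icc (0 : ℝ) 1, s f t := by
      refine setIntegral_mono_set (hG.2 f) ?_ hA1.eventuallyLE
      filter_upwards [ae_restrict_mem measurableSet_Icc] with t ht
      exact toReal_supp_nonneg (h0 t ht) f
    linarith [hx f]
  refine ⟨Family.mem_of_subset hN₁ hMcc hMN, fun y => ?_⟩
  rw [supp_eq_coe_iff hMne]
  constructor
  · rintro _ ⟨x, hx, rfl⟩
    exact hx y
  · intro u hu
    refine le_of_forall_pos_le_add fun η hη => ?_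
    obtain ⟨x, hx, hxy⟩ := happrox y η hη
    linarith [hu (mem_image_of_mem y hx)]

/-- The indefinite Pettis integral is dominated by the integral of the diameter. -/
lemma hNorm_le_lintegral {𝒞 : Set (Set X)} {G : ℝ → Set X}
    (h0 : ∀ t ∈ Icc (0 : ℝ) 1, (0 : X) ∈ G t) {g : ℝ → ℝ≥0∞} (hg : Measurable g)
    (hGg : ∀ t ∈ Icc (0 : ℝ) 1, diamFn G t ≤ g t) {M : Set ℝ → Set X}
    (hM : IsPettisIntegral 𝒞 G M) {A : Set ℝ} (hA : NullMeasurableSet A volume)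
    (hA1 : A ⊆ Icc 0 1) : hNorm (M A) ≤ ∫⁻ t in A, g t := by
  refine iSup₂_le fun x hx => ?_
  -- A norming functional reduces the norm bound to one scalar integral.
  obtain ⟨y, hy1, hyx⟩ := exists_dual_vector'' ℝ x
  have hle : y x ≤ ∫ t in A, (supp y (G t)).toReal :=
    ((supp_eq_coe_iff ⟨x, hx⟩).1 ((hM.2 A hA hA1).2 y)).1 (mem_image_of_mem y hx)
  calc ‖x‖ₑ = ENNReal.ofReal (y x) := by
        rw [hyx]
        exact (ofReal_norm x).symm
    _ ≤ ‖∫ t in A, (supp y (G t)).toReal‖ₑ := by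
        rw [← ofReal_norm]
        exact ENNReal.ofReal_le_ofReal (hle.trans (le_abs_self _))
    _ ≤ ‖y‖ₑ * ∫⁻ t in A, g t :=
        enorm_setIntegral_le hg (fun t ht => (enorm_toReal_supp_le (h0 t ht) y).trans
          (by gcongr; exact hGg t ht)) hA1
    _ ≤ 1 * ∫⁻ t in A, g t := by
        gcongr
        rw [← ofReal_norm]
        exact ENNReal.ofReal_le_one.2 hy1
    _ = ∫⁻ t in A, g t := one_mul _

/-! ### Upper integrals and their measurable majorants. -/

lemma exists_majorant {φ : ℝ → ℝ≥0∞} (h : upperIntegral φ < ⊤) :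
    ∃ g : ℝ → ℝ≥0∞, Measurable g ∧ (∀ t ∈ Icc (0 : ℝ) 1, φ t ≤ g t) ∧
      ∫⁻ t in Icc (0 : ℝ) 1, g t < ⊤ := by
  simp only [upperIntegral, iInf_lt_iff] at h
  obtain ⟨g, hg, hφ, hlt⟩ := h
  exact ⟨g, hg, hφ, hlt⟩

lemma upperIntegral_le {φ g : ℝ → ℝ≥0∞} (hg : Measurable g)
    (h : ∀ t ∈ Icc (0 : ℝ) 1, φ t ≤ g t) : upperIntegral φ ≤ ∫⁻ t in Icc (0 : ℝ) 1, g t :=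
  iInf_le_of_le g (iInf₂_le hg h)

lemma upperIntegral_mono {φ ψ : ℝ → ℝ≥0∞} (h : ∀ t ∈ Icc (0 : ℝ) 1, φ t ≤ ψ t) :
    upperIntegral φ ≤ upperIntegral ψ :=
  le_iInf fun _ => le_iInf₂ fun hg hψ =>
    upperIntegral_le hg fun t ht => (h t ht).trans (hψ t ht)

/-- An essentially bounded function has finite upper integral. -/
lemma upperIntegral_lt_top_of_essSup {φ : ℝ → ℝ≥0∞}
    (h : essSup φ (volume.restrict (Icc (0 : ℝ) 1)) < ⊤) : upperIntegral φ < ⊤ := by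
  classical
  set c := essSup φ (volume.restrict (Icc (0 : ℝ) 1)) with hc
  have hae : ∀ᵐ t ∂(volume.restrict (Icc (0 : ℝ) 1)), φ t ≤ c := ae_le_essSup
  set Z := toMeasurable (volume.restrict (Icc (0 : ℝ) 1)) {t | ¬ φ t ≤ c} with hZ
  have hZm : MeasurableSet Z := measurableSet_toMeasurable _ _
  have hZ0 : volume.restrict (Icc (0 : ℝ) 1) Z = 0 := by
    rw [hZ, measure_toMeasurable]
    exact hae
  -- A majorant must dominate everywhere, so it is `⊤` on the exceptional null set.
  set g : ℝ → ℝ≥0∞ := Z.piecewise (fun _ => ⊤) fun _ => c with hgdef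
  have hg : Measurable g := measurable_const.piecewise hZm measurable_const
  refine (upperIntegral_le hg fun t _ => ?_).trans_lt ?_
  · by_cases ht : t ∈ Z
    · rw [hgdef, piecewise_eq_of_mem _ _ _ ht]
      exact le_top
    · rw [hgdef, piecewise_eq_of_notMem _ _ _ ht]
      by_contra hlt
      exact ht (subset_toMeasurable _ _ hlt)
  · have : g =ᵐ[volume.restrict (Icc (0 : ℝ) 1)] fun _ => c := by
      filter_upwards [measure_eq_zero_iff_ae_notMem.1 hZ0] with t ht
      exact piecewise_eq_of_notMem _ _ _ ht
    rw [lintegral_congr_ae this]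
    simpa using h

end SupportFunctions

/-! ### The difference of a multifunction and an integrable selection -/

variable {X : Type*} [NormedAddCommGroup X]

/-- The multifunction `Γ - f`. -/
def translate (Γ : ℝ → Set X) (f : ℝ → X) (t : ℝ) : Set X := (fun x => x - f t) '' Γ t

lemma zero_mem_translate {Γ : ℝ → Set X} {f : ℝ → X} {t : ℝ} (h : f t ∈ Γ t) :
    (0 : X) ∈ translate Γ f t := ⟨f t, h, sub_self _⟩

lemma diamFn_translate (Γ : ℝ → Set X) (f : ℝ → X) (t : ℝ) :
    diamFn (translate Γ f) t = diamFn Γ t := by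
  have : Isometry fun x : X => x - f t := (IsometryEquiv.subRight (f t)).isometry
  exact this.ediam_image _

lemma hNorm_le_ediam {C : Set X} (h0 : (0 : X) ∈ C) : hNorm C ≤ Metric.ediam C :=
  iSup₂_le fun x hx => by
    rw [← edist_zero_right]
    exact Metric.edist_le_ediam_of_mem hx h0

lemma ediam_le_two_mul_hNorm (C : Set X) : Metric.ediam C ≤ 2 * hNorm C := by
  refine Metric.ediam_le fun x hx z hz => ?_
  have hle : ∀ w ∈ C, ‖w‖ₑ ≤ hNorm C := fun w hw => le_iSup₂ (f := fun x (_ : x ∈ C) => ‖x‖ₑ) w hw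
  calc edist x z ≤ ‖x‖ₑ + ‖z‖ₑ := by
        rw [edist_eq_enorm_sub]
        exact enorm_sub_le
    _ ≤ 2 * hNorm C := by
        rw [two_mul]
        exact add_le_add (hle x hx) (hle z hz)

variable [NormedSpace ℝ X]

/-! ### Integrals of the translate over intervals. -/

lemma ScalarIntegral.IntegrableIn.scalarlyFinite {k : ScalarIntegral} {𝒞 : Set (Set X)}
    {Γ : ℝ → Set X} (h : k.IntegrableIn 𝒞 Γ) : ScalarlyFinite Γ := by
  cases k with
  | pettis => obtain ⟨M, hM⟩ := h; exact hM.1.1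
  | wMS => exact h.2.1
  | HKP => exact h.1
  | DKP => exact h.1

lemma ScalarlyFinite.ae_supp_translate {Γ : ℝ → Set X} {f : ℝ → X} (h : ScalarlyFinite Γ)
    (hf : ∀ t ∈ Icc (0 : ℝ) 1, f t ∈ Γ t) (y : X →L[ℝ] ℝ) :
    ∀ᵐ t ∂(volume.restrict (Icc (0 : ℝ) 1)), supp y (translate Γ f t) =
      (((supp y (Γ t)).toReal - (supp y {f t}).toReal : ℝ) : EReal) := by
  filter_upwards [h y, ae_restrict_mem measurableSet_Icc] with t ht hmem
  rw [supp_singleton, EReal.toReal_coe]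
  exact supp_image_sub ⟨f t, hf t hmem⟩ (EReal.coe_toReal ht.1 ht.2).symm _

/-- The relation `R` stands for either conditional integral: subtraction, a.e. invariance and
Lebesgue integrability of nonnegative functions are all that is used. -/
lemma ScalarlyFinite.integral_translate {Γ : ℝ → Set X} {f : ℝ → X} (hΓ : ScalarlyFinite Γ)
    (hsel : ∀ t ∈ Icc (0 : ℝ) 1, f t ∈ Γ t) {a b : ℝ} (ha : 0 ≤ a) (hb : b ≤ 1)
    {R : (ℝ → ℝ) → ℝ → ℝ → ℝ → Prop}
    (hsub : ∀ {φ ψ : ℝ → ℝ} {v w : ℝ}, R φ a b v → R ψ a b w →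
      R (fun t => φ t - ψ t) a b (v - w))
    (hcongr : ∀ {φ ψ : ℝ → ℝ} {v : ℝ}, R φ a b v →
      (∀ᵐ t ∂(volume.restrict (Icc a b)), φ t = ψ t) → R ψ a b v)
    (hnonneg : ∀ {φ : ℝ → ℝ} {v : ℝ}, R φ a b v →
      (∀ᵐ t ∂(volume.restrict (Icc a b)), 0 ≤ φ t) →
      IntegrableOn φ (Icc a b) ∧ ∫ t in Icc a b, φ t = v)
    {y : X →L[ℝ] ℝ} {v w : ℝ} (hv : R (fun t => (supp y (Γ t)).toReal) a b v)
    (hw : R (fun t => (supp y {f t}).toReal) a b w) :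
    IntegrableOn (fun t => (supp y (translate Γ f t)).toReal) (Icc a b) ∧
      ∫ t in Icc a b, (supp y (translate Γ f t)).toReal = v - w := by
  have hI : Icc a b ⊆ Icc 0 1 := Icc_subset_Icc ha hb
  refine hnonneg (hcongr (hsub hv hw) ?_) ?_
  · filter_upwards [ae_restrict_of_ae_restrict_of_subset hI
      (hΓ.ae_supp_translate hsel y)] with t ht
    rw [ht, EReal.toReal_coe]
  · filter_upwards [ae_restrict_mem measurableSet_Icc] with t ht
    exact toReal_supp_nonneg (zero_mem_translate (hsel t (hI ht))) y

lemma HKPIntegrable.integral_translate {𝒞 : Set (Set X)} {Γ : ℝ → Set X} {f : ℝ → X}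
    (hΓ : HKPIntegrable 𝒞 Γ)
    (hf : HKPIntegrable (range fun x : X => ({x} : Set X)) fun t => {f t})
    (hsel : ∀ t ∈ Icc (0 : ℝ) 1, f t ∈ Γ t) {a b : ℝ} (ha : 0 ≤ a) (hab : a < b) (hb : b ≤ 1) :
    ∃ N ∈ 𝒞, ∃ z : X, ∀ y : X →L[ℝ] ℝ, ∃ v : ℝ, supp y N = (v : EReal) ∧
      IntegrableOn (fun t => (supp y (translate Γ f t)).toReal) (Icc a b) ∧
      ∫ t in Icc a b, (supp y (translate Γ f t)).toReal = v - y z := by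
  obtain ⟨N, hN, hNy⟩ := hΓ.2 a b ha hab hb
  obtain ⟨_, ⟨z, rfl⟩, hz⟩ := hf.2 a b ha hab hb
  refine ⟨N, hN, z, fun y => ?_⟩
  obtain ⟨v, hv, hvN⟩ := hNy y
  obtain ⟨w, hw, hwz⟩ := hz y
  rw [supp_singleton, EReal.coe_eq_coe_iff] at hwz
  rw [hwz]
  exact ⟨v, hvN, hΓ.1.integral_translate hsel ha hb (R := HasHKIntegral) HasHKIntegral.sub
    HasHKIntegral.congr_ae HasHKIntegral.integrableOn_of_nonneg hv hw⟩

lemma DKPIntegrable.integral_translate {𝒞 : Set (Set X)} {Γ : ℝ → Set X} {f : ℝ → X}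
    (hΓ : DKPIntegrable 𝒞 Γ)
    (hf : DKPIntegrable (range fun x : X => ({x} : Set X)) fun t => {f t})
    (hsel : ∀ t ∈ Icc (0 : ℝ) 1, f t ∈ Γ t) {a b : ℝ} (ha : 0 ≤ a) (hab : a < b) (hb : b ≤ 1) :
    ∃ N ∈ 𝒞, ∃ z : X, ∀ y : X →L[ℝ] ℝ, ∃ v : ℝ, supp y N = (v : EReal) ∧
      IntegrableOn (fun t => (supp y (translate Γ f t)).toReal) (Icc a b) ∧
      ∫ t in Icc a b, (supp y (translate Γ f t)).toReal = v - y z := by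
  obtain ⟨N, hN, hNy⟩ := hΓ.2 a b ha hab hb
  obtain ⟨_, ⟨z, rfl⟩, hz⟩ := hf.2 a b ha hab hb
  refine ⟨N, hN, z, fun y => ?_⟩
  obtain ⟨v, hv, hvN⟩ := hNy y
  obtain ⟨w, hw, hwz⟩ := hz y
  rw [supp_singleton, EReal.coe_eq_coe_iff] at hwz
  rw [hwz]
  exact ⟨v, hvN, hΓ.1.integral_translate hsel ha hb (R := HasDKIntegral) HasDKIntegral.sub
    HasDKIntegral.congr_ae HasDKIntegral.integrableOn_of_nonneg hv hw⟩

lemma PettisIntegrable.integral_translate {𝒞 : Set (Set X)} {Γ : ℝ → Set X} {f : ℝ → X}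
    (hΓ : PettisIntegrable 𝒞 Γ)
    (hf : PettisIntegrable (range fun x : X => ({x} : Set X)) fun t => {f t})
    (hsel : ∀ t ∈ Icc (0 : ℝ) 1, f t ∈ Γ t) {a b : ℝ} (ha : 0 ≤ a) (hb : b ≤ 1) :
    ∃ N ∈ 𝒞, ∃ z : X, ∀ y : X →L[ℝ] ℝ, ∃ v : ℝ, supp y N = (v : EReal) ∧
      IntegrableOn (fun t => (supp y (translate Γ f t)).toReal) (Icc a b) ∧
      ∫ t in Icc a b, (supp y (translate Γ f t)).toReal = v - y z := by
  obtain ⟨M, hM, hMA⟩ := hΓ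
  obtain ⟨L, hL, hLA⟩ := hf
  have hsub : Icc a b ⊆ Icc 0 1 := Icc_subset_Icc ha hb
  obtain ⟨hN, hNy⟩ := hMA (Icc a b) measurableSet_Icc.nullMeasurableSet hsub
  obtain ⟨⟨z, hzL⟩, hzy⟩ := hLA (Icc a b) measurableSet_Icc.nullMeasurableSet hsub
  refine ⟨_, hN, z, fun y => ⟨_, hNy y, ?_⟩⟩
  have h1 := hzy y
  rw [← hzL, supp_singleton, EReal.coe_eq_coe_iff] at h1
  have hi := (hM.2 y).mono_set hsub
  have hj := (hL.2 y).mono_set hsub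
  have hae : ∀ᵐ t ∂(volume.restrict (Icc a b)), (supp y (Γ t)).toReal - (supp y {f t}).toReal =
      (supp y (translate Γ f t)).toReal := by
    filter_upwards [ae_restrict_of_ae_restrict_of_subset hsub
      (hM.1.ae_supp_translate hsel y)] with t ht
    rw [ht, EReal.toReal_coe]
  refine ⟨(hi.sub hj).congr hae, ?_⟩
  rw [h1, ← integral_congr_ae hae, integral_sub hi hj]

/-- From here on the four senses of integrability are treated alike. One pair `N`, `z` serves all
functionals. -/
lemma ScalarIntegral.IntegrableIn.integral_translate {k : ScalarIntegral} {𝒞 : Set (Set X)}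
    {Γ : ℝ → Set X} {f : ℝ → X} (hΓ : k.IntegrableIn 𝒞 Γ) (hf : IsIntegrableSelection k Γ f)
    {a b : ℝ} (ha : 0 ≤ a) (hab : a < b) (hb : b ≤ 1) :
    ∃ N ∈ 𝒞, ∃ z : X, ∀ y : X →L[ℝ] ℝ, ∃ v : ℝ, supp y N = (v : EReal) ∧
      IntegrableOn (fun t => (supp y (translate Γ f t)).toReal) (Icc a b) ∧
      ∫ t in Icc a b, (supp y (translate Γ f t)).toReal = v - y z := by
  obtain ⟨hf, hsel⟩ := hf
  cases k with
  | pettis => exact PettisIntegrable.integral_translate hΓ hf hsel ha hb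
  | wMS => exact HKPIntegrable.integral_translate hΓ.1 hf.1 hsel ha hab hb
  | HKP => exact HKPIntegrable.integral_translate hΓ hf hsel ha hab hb
  | DKP => exact DKPIntegrable.integral_translate hΓ hf hsel ha hab hb

theorem isDecomposition_translate [CompleteSpace X] {k : ScalarIntegral} {F : Family}
    {Γ : ℝ → Set X} {f : ℝ → X} (hΓ : ∀ t ∈ Icc (0 : ℝ) 1, Γ t ∈ closedConvexSets X)
    (hint : k.IntegrableIn (F.sets X) Γ) (hf : IsIntegrableSelection k Γ f)
    (hDL : DLCondition Γ) : IsDecomposition k (F.sets X) Γ (translate Γ f) f where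
  selection := hf
  values t ht := closedConvexSets.image_sub (hΓ t ht) (f t)
  eq_add t _ := by
    rw [translate, image_image]
    simp
  pettis := by
    obtain ⟨g, hg, hGg, hgfin⟩ := exists_majorant hDL
    have hfin : ScalarlyIntegrable (translate Γ f) := by
      refine ⟨fun y => ?_, fun y => ?_⟩
      · filter_upwards [hint.scalarlyFinite.ae_supp_translate hf.2 y] with t ht
        rw [ht]
        exact ⟨EReal.coe_ne_top _, EReal.coe_ne_bot _⟩
      · obtain ⟨N, -, z, h⟩ := hint.integral_translate hf le_rfl one_pos le_rfl
        obtain ⟨v, -, h', -⟩ := h y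
        exact h'
    refine exists_isPettisIntegral_of_intervals F (fun t ht => zero_mem_translate (hf.2 t ht))
      hfin hg hgfin (fun t ht => (diamFn_translate Γ f t).trans_le (hGg t ht)) ?_
    intro a b ha hab hb
    obtain ⟨N, hN, z, h⟩ := hint.integral_translate hf ha hab hb
    refine ⟨_, F.image_sub_mem hN z, fun y => ?_⟩
    obtain ⟨v, hv, -, h'⟩ := h y
    rw [h']
    exact supp_image_sub (F.sets_subset hN).1 hv z

lemma IsDecomposition.zero_mem {k : ScalarIntegral} {𝒞 : Set (Set X)} {Γ G : ℝ → Set X}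
    {f : ℝ → X} (h : IsDecomposition k 𝒞 Γ G f) {t : ℝ} (ht : t ∈ Icc (0 : ℝ) 1) :
    (0 : X) ∈ G t := by
  have hmem := h.selection.2 t ht
  rw [h.eq_add t ht] at hmem
  obtain ⟨x, hx, hxf⟩ := hmem
  have : x = 0 := by simpa using hxf
  rwa [this] at hx

lemma IsDecomposition.diamFn_eq {k : ScalarIntegral} {𝒞 : Set (Set X)} {Γ G : ℝ → Set X}
    {f : ℝ → X} (h : IsDecomposition k 𝒞 Γ G f) {t : ℝ} (ht : t ∈ Icc (0 : ℝ) 1) :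
    diamFn Γ t = diamFn G t := by
  have : Isometry fun x : X => x + f t := (IsometryEquiv.addRight (f t)).isometry
  rw [diamFn, h.eq_add t ht]
  exact this.ediam_image _

lemma variation_lt_top {𝒞 : Set (Set X)} {G : ℝ → Set X}
    (h0 : ∀ t ∈ Icc (0 : ℝ) 1, (0 : X) ∈ G t) (hG : upperIntegral (diamFn G) < ⊤)
    {M : Set ℝ → Set X} (hM : IsPettisIntegral 𝒞 G M) : variation M < ⊤ := by
  obtain ⟨g, hg, hGg, hgfin⟩ := exists_majorant hG
  refine lt_of_le_of_lt (iSup_le fun P => iSup₂_le fun hP hdis => iSup_le fun hU => ?_) hgfin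
  rw [← hU, lintegral_biUnion_finset₀ (t := fun A : Set ℝ => A)
    (fun A hA B hB hAB => (hdis hA hB hAB).aedisjoint) hP]
  refine Finset.sum_le_sum fun A hA => hNorm_le_lintegral h0 hg hGg hM (hP A hA) ?_
  rw [← hU]
  exact subset_biUnion_of_mem (u := fun A : Set ℝ => A) hA

end MultiInt

/-! ### The decomposition theorem. -/

theorem mainTheorem6 {X : Type*} [NormedAddCommGroup X] [NormedSpace ℝ X] [CompleteSpace X]
    (k : MultiInt.ScalarIntegral) (F : MultiInt.Family) (Γ : ℝ → Set X)
    (hΓ : ∀ t ∈ Set.Icc (0 : ℝ) 1, Γ t ∈ MultiInt.closedConvexSets X)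
    (hint : k.IntegrableIn (F.sets X) Γ)
    (hsel : ∃ f : ℝ → X, MultiInt.IsIntegrableSelection k Γ f) :
    (MultiInt.DLCondition Γ ↔
      ∃ (G : ℝ → Set X) (f : ℝ → X), MultiInt.IsDecomposition k (F.sets X) Γ G f ∧
        MultiInt.upperIntegral (MultiInt.diamFn G) < ⊤) ∧
    (MultiInt.DbCondition Γ ↔
      ∃ (G : ℝ → Set X) (f : ℝ → X), MultiInt.IsDecomposition k (F.sets X) Γ G f ∧
        MultiInt.upperIntegral (MultiInt.diamFn G) < ⊤ ∧ MultiInt.EssBounded G) ∧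
    (∀ (G : ℝ → Set X) (f : ℝ → X), MultiInt.IsDecomposition k (F.sets X) Γ G f →
      MultiInt.upperIntegral (MultiInt.diamFn G) < ⊤ →
      ∀ M : Set ℝ → Set X, MultiInt.IsPettisIntegral (F.sets X) G M →
        MultiInt.variation M < ⊤) := by
  obtain ⟨f, hf⟩ := hsel
  have hdiam : MultiInt.diamFn (MultiInt.translate Γ f) = MultiInt.diamFn Γ :=
    funext (MultiInt.diamFn_translate Γ f)
  refine ⟨⟨fun hDL => ⟨_, f, MultiInt.isDecomposition_translate hΓ hint hf hDL, ?_⟩, ?_⟩,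
    ⟨fun hDb => ?_, ?_⟩, fun G f' hdec hG M hM =>
      MultiInt.variation_lt_top (fun t ht => hdec.zero_mem ht) hG hM⟩
  · rw [hdiam]
    exact hDL
  · rintro ⟨G, f', hdec, hG⟩
    exact (MultiInt.upperIntegral_mono fun t ht => (hdec.diamFn_eq ht).le).trans_lt hG
  · have hDL : MultiInt.DLCondition Γ := MultiInt.upperIntegral_lt_top_of_essSup hDb
    refine ⟨_, f, MultiInt.isDecomposition_translate hΓ hint hf hDL, ?_, ?_⟩
    · rw [hdiam]
      exact hDL
    · refine lt_of_le_of_lt (essSup_mono_ae ?_) hDb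
      filter_upwards [ae_restrict_mem measurableSet_Icc] with t ht
      rw [← hdiam]
      exact MultiInt.hNorm_le_ediam (MultiInt.zero_mem_translate (hf.2 t ht))
  · rintro ⟨G, f', hdec, -, hG⟩
    -- Translation preserves diameters, and the diameter is at most twice `‖G(t)‖_h`, so the
    -- essential bound transfers to `Γ`.
    have hle : ∀ᵐ t ∂(volume.restrict (Icc (0 : ℝ) 1)),
        MultiInt.diamFn Γ t ≤ 2 * MultiInt.hNorm (G t) := by
      filter_upwards [ae_restrict_mem measurableSet_Icc] with t ht
      rw [hdec.diamFn_eq ht]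
      exact MultiInt.ediam_le_two_mul_hNorm _
    refine lt_of_le_of_lt (essSup_mono_ae hle) ?_
    rw [ENNReal.essSup_const_mul]
    exact ENNReal.mul_lt_top ENNReal.ofNat_lt_top hG
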